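/- For a real matrix $M$ let $\|M\|_{1,2}$ be the sum of the Euclidean norms of its rows and $\|M\|_h=\|M^{\mathsf T}\|_{1,2}$ the sum of the Euclidean norms of its columns. For $A\in\mathbb R^{n\times d}$ let $\mathrm{SubApx}_{k,1}(A)=\min_P\sum_{i=1}^n \mathrm{dist}(A_{i*},P)$, the minimum being over linear subspaces $P\subseteq\mathbb R^d$ with $\dim P\le k$ and $\mathrm{dist}$ the Euclidean distance. A matrix $S$ is a lopsided $\epsilon$-embedding for $(V,B)$ with respect to $\|\cdot\|_h$ if $\|S(VX-B)\|_h\ge(1-\epsilon)\|VX-B\|_h$ for all matrices $X$ and $\|S(VX^*-B)\|_h\le(1+\epsilon)\|VX^*-B\|_h$ for every minimizer $X^*$ of $\|VX-B\|_h$. A Gaussian $t\times d$ matrix has independent $N(0,1/t)$ entries. There is an absolute constant $C>0$ such that the following holds for all $n,d\ge 0$, $k\ge 1$ and $A\in\mathbb R^{n\times d}$. (i) Let $t\ge Ck$ and let $S$ be a Gaussian $t\times d$ matrix. For all $U_k\in\mathbb R^{n\times k}$ and $V_k\in\mathbb R^{d\times k}$ with $\|U_kV_k^{\mathsf T}-A\|_{1,2}=\mathrm{SubApx}_{k,1}(A)$,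 $S$ is a lopsided $\tfrac14$-embedding for $(V_k,A^{\mathsf T})$ with respect to $\|\cdot\|_h$ with probability at least $9/10$. Moreover, with probability at least $9/10$, $$\min_{\mathrm{rank}\,X\le k}\|AS^{\mathsf T}X-A\|_{1,2}\le \tfrac32\,\mathrm{SubApx}_{k,1}(A),\qquad(1)$$ the minimum (over $X\in\mathbb R^{t\times d}$) being attained. (ii) Let $S$ be a random $t\times d$ matrix that is either Gaussian with $t\ge Ck$, or has any distribution for which (1) holds with probability at least $9/10$. Let $\alpha>0$ and $\beta$ be real numbers, and let $L\in\mathbb R^{m\times n}$ be a random matrix, whose distribution may depend on $S$, such that with probability at least $9/10$ $$\alpha\|AS^{\mathsf T}y\|_1\le\|LAS^{\mathsf T}y\|_1\le\beta\|AS^{\mathsf T}y\|_1\quad\text{for all } y\in\mathbb R^t,$$ and such that, conditionally on $S$ (for almost every $S$), $\mathbb E_L\|LM\|_{1,2}=\|M\|_{1,2}$ for every fixed matrix $M$ with $n$ rows. Then with probability at least $3/5$, every matrix $X\in\mathbb R^{t\times d}$ with $\|LAS^{\mathsf T}X-LA\|_{1,2}\le 10\,\mathrm{SubApx}_{k,1}(A)$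 satisfies $$\|AS^{\mathsf T}X-A\|_{1,2}\le\Bigl(2+\frac{40}{\alpha}\Bigr)\mathrm{SubApx}_{k,1}(A).$$ -/

import Mathlib

open MeasureTheory ProbabilityTheory
open scoped Matrix NNReal

noncomputable section

/-- The `(1,2)`-norm of a matrix: the sum of the Euclidean norms of its rows. -/
def norm12 {n d : ℕ} (M : Matrix (Fin n) (Fin d) ℝ) : ℝ :=
  ∑ i, ‖(WithLp.toLp 2 (M i) : EuclideanSpace ℝ (Fin d))‖

/-- The norm `‖M‖_h`: the sum of the Euclidean norms of the columns of `M`. -/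
def normH {n d : ℕ} (M : Matrix (Fin n) (Fin d) ℝ) : ℝ := norm12 Mᵀ

/-- The `ℓ₁` norm of a vector. -/
def norm1 {n : ℕ} (v : Fin n → ℝ) : ℝ := ∑ i, |v i|

/-- The optimum value of `(k,1)`-subspace approximation: the infimum, over all linear subspaces `P`
of `ℝᵈ` of dimension at most `k`, of the sum of the Euclidean distances of the rows of `A`
to `P`. -/
def subApx {n d : ℕ} (k : ℕ) (A : Matrix (Fin n) (Fin d) ℝ) : ℝ :=
  ⨅ P : {P : Submodule ℝ (EuclideanSpace ℝ (Fin d)) // Module.finrank ℝ P ≤ k},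
    ∑ i, Metric.infDist (WithLp.toLp 2 (A i) : EuclideanSpace ℝ (Fin d))
      (P.1 : Set (EuclideanSpace ℝ (Fin d)))

/-- `S` is a lopsided `ε`-embedding for `(A, B)` with respect to the matrix norm `N` (given in all
sizes) and the constraint set `𝒞`: `S` contracts no `A X - B` by more than `1 - ε`, and
it dilates the residual `A X* - B` of a minimizer `X*` over `𝒞` by at most `1 + ε`. -/
def IsLopsidedEmbedding {t d k n : ℕ}
    (N : ∀ {p q : ℕ}, Matrix (Fin p) (Fin q) ℝ → ℝ)
    (𝒞 : Set (Matrix (Fin k) (Fin n) ℝ)) (ε : ℝ)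
    (A : Matrix (Fin d) (Fin k) ℝ) (B : Matrix (Fin d) (Fin n) ℝ)
    (S : Matrix (Fin t) (Fin d) ℝ) : Prop :=
  (∀ X : Matrix (Fin k) (Fin n) ℝ, (1 - ε) * N (A * X - B) ≤ N (S * (A * X - B))) ∧
  (∀ X ∈ 𝒞, IsMinOn (fun Y => N (A * Y - B)) 𝒞 X →
    N (S * (A * X - B)) ≤ (1 + ε) * N (A * X - B))

/-- Matrices carry the product (equivalently, Borel) σ-algebra. -/
instance matrixMeasurableSpace {p q : ℕ} : MeasurableSpace (Matrix (Fin p) (Fin q) ℝ) :=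
  inferInstanceAs (MeasurableSpace (Fin p → Fin q → ℝ))

/-- The law of a (scaled) Gaussian `t × d` matrix: independent `N(0, 1/t)` entries. -/
def gaussianMatrix (t d : ℕ) : Measure (Matrix (Fin t) (Fin d) ℝ) :=
  (Measure.pi fun _ : Fin t => Measure.pi fun _ : Fin d =>
    gaussianReal 0 ((t : ℝ≥0)⁻¹)).map Matrix.of

/-- `min_{rank X ≤ k} ‖A Sᵀ X - A‖_{1,2} ≤ (3/2) SubApx_{k,1}(A)`, the minimum being attained. -/
def IsGoodSketch {n d t : ℕ} (k : ℕ) (A : Matrix (Fin n) (Fin d) ℝ)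
    (S : Matrix (Fin t) (Fin d) ℝ) : Prop :=
  ∃ X : Matrix (Fin t) (Fin d) ℝ, X.rank ≤ k ∧
    IsMinOn (fun Y => norm12 (A * Sᵀ * Y - A)) {Y | Y.rank ≤ k} X ∧
    norm12 (A * Sᵀ * X - A) ≤ 3 / 2 * subApx k A

/-- `L` is an `(α, β)` `ℓ₁` subspace embedding for (the column space of) `M`. -/
def IsL1SubspaceEmbedding {m n t : ℕ} (α β : ℝ) (M : Matrix (Fin n) (Fin t) ℝ)
    (L : Matrix (Fin m) (Fin n) ℝ) : Prop :=
  ∀ y : Fin t → ℝ, α * norm1 (M *ᵥ y) ≤ norm1 ((L * M) *ᵥ y) ∧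
    norm1 ((L * M) *ᵥ y) ≤ β * norm1 (M *ᵥ y)

/-- A law `ν` of a random matrix `L` is unbiased for the `(1,2)`-norm:
`E ‖L M‖_{1,2} = ‖M‖_{1,2}` for every fixed matrix `M`. -/
def IsUnbiased12 {m n : ℕ} (ν : Measure (Matrix (Fin m) (Fin n) ℝ)) : Prop :=
  ∀ (p : ℕ) (M : Matrix (Fin n) (Fin p) ℝ),
    Integrable (fun L => norm12 (L * M)) ν ∧ ∫ L, norm12 (L * M) ∂ν = norm12 M

/-- Let `S` have law `μ` and let `L` be a random matrix, drawn possibly depending on `S`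
(a Markov kernel `κ` gives its conditional law).  If, for almost every `S`, the law of `L` is
unbiased for the `(1,2)`-norm, and if with probability at least `9/10` the matrix `L` is
an `(α, β)` `ℓ₁` subspace embedding for `A Sᵀ`, then with probability at least `3/5`, every `X` of
sketched cost at most `10 SubApx_{k,1}(A)` has cost at most `(2 + 40/α) SubApx_{k,1}(A)`. -/
def SketchedCostTransfers {n d t : ℕ} (k : ℕ) (A : Matrix (Fin n) (Fin d) ℝ)
    (μ : Measure (Matrix (Fin t) (Fin d) ℝ)) : Prop :=
  ∀ (m : ℕ) (κ : Kernel (Matrix (Fin t) (Fin d) ℝ) (Matrix (Fin m) (Fin n) ℝ))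
    [IsMarkovKernel κ] (α β : ℝ), 0 < α →
    (∀ᵐ S ∂μ, IsUnbiased12 (κ S)) →
    9 / 10 ≤ (μ ⊗ₘ κ) {q | IsL1SubspaceEmbedding α β (A * q.1ᵀ) q.2} →
    3 / 5 ≤ (μ ⊗ₘ κ) {q | ∀ X : Matrix (Fin t) (Fin d) ℝ,
      norm12 (q.2 * A * q.1ᵀ * X - q.2 * A) ≤ 10 * subApx k A →
      norm12 (A * q.1ᵀ * X - A) ≤ (2 + 40 / α) * subApx k A}

end

/-! Fix a subspace `K` of dimension at most `k` and residuals `r i` orthogonal to it. Everything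
about Gaussian sketches follows from `gaussianMatrix_sum_norm`: with probability `9/10`,
simultaneously for all `v i` in `K`, `S` shrinks `∑ ‖v i + r i‖` by at most `4/5` and stretches `∑
‖r i‖` by at most `6/5`. No union bound over the `n` rows is needed. On `K` itself `S` is a subspace
embedding, by a net argument. Orthogonally to `K`, the cross terms `⟨S v, S u⟩` are controlled for
all `v` in `K` at once by the `sketchErr` of the unit vector `u`, whose mean is `O(k/t)`; Markov's
inequality, weighted by `‖r i‖`, makes its average small (`sum_norm_map_ge`).

For the lopsided embedding, `K` is the column space of `V`. For the good sketch, `K` is the row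
space of an optimal rank-`k` approximation: solving the sketched regression onto `K` costs at most
`(6/5)/(4/5) = 3/2` times the optimum, and its solution is linear in the row, hence of the form `A
Sᵀ X`.

For the transfer, Gaussian averaging turns an `ℓ₁` bound on vectors into a `(1,2)`-bound on matrices
(`norm12_mul_le_of_norm1_mulVec_le`). Unbiasedness of `L` is used only through Markov's inequality
at a single good solution `Y`; the triangle inequality then compares any `X` with `Y`. -/

/-! ### Moments and tails of the Gaussian sketch of one vector. -/

/-- A linear functional of a vector with independent centred Gaussian entries is Gaussian. -/
theorem map_dotProduct_pi_gaussianReal {d : ℕ} (v : ℝ≥0) (a : Fin d → ℝ) :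
    (Measure.pi fun _ : Fin d => gaussianReal 0 v).map (fun s => s ⬝ᵥ a) =
      gaussianReal 0 (v * ‖(WithLp.toLp 2 a : EuclideanSpace ℝ (Fin d))‖₊ ^ 2) := by
  have hm : Measurable (fun s : Fin d → ℝ => s ⬝ᵥ a) := by
    unfold dotProduct; fun_prop
  have := Measure.isProbabilityMeasure_map (μ := Measure.pi fun _ : Fin d => gaussianReal 0 v)
    hm.aemeasurable
  apply Measure.ext_of_charFun
  ext z
  rw [charFun_gaussianReal, charFun_apply, integral_map hm.aemeasurable (by fun_prop)]
  -- By independence the characteristic function is a product of one-dimensional ones.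
  have h1 : ∀ s : Fin d → ℝ, Complex.exp (((inner ℝ (s ⬝ᵥ a) z : ℝ) : ℂ) * Complex.I) =
      ∏ j, Complex.exp (((inner ℝ (s j) (z * a j) : ℝ) : ℂ) * Complex.I) := by
    intro s
    rw [← Complex.exp_sum]
    congr 1
    rw [← Finset.sum_mul]
    congr 1
    simp only [dotProduct, RCLike.inner_apply, conj_trivial]
    push_cast
    rw [Finset.mul_sum]
    refine Finset.sum_congr rfl fun j _ => by ring
  simp_rw [h1]
  rw [integral_fintype_prod_eq_prod (fun j x =>
    Complex.exp (((inner ℝ x (z * a j) : ℝ) : ℂ) * Complex.I))]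
  simp_rw [← charFun_apply, charFun_gaussianReal]
  rw [← Complex.exp_sum]
  congr 1
  have h2 : (‖(WithLp.toLp 2 a : EuclideanSpace ℝ (Fin d))‖ : ℝ) ^ 2 = ∑ j, a j ^ 2 := by
    rw [EuclideanSpace.norm_sq_eq]; simp
  have h3 : (((v * ‖(WithLp.toLp 2 a : EuclideanSpace ℝ (Fin d))‖₊ ^ 2 : ℝ≥0) : ℝ) : ℂ) =
      v * ∑ j, (a j : ℂ) ^ 2 := by
    push_cast
    congr 1
    rw [← Complex.ofReal_pow, h2]; push_cast; rfl
  rw [h3]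
  push_cast
  simp only [mul_zero, zero_mul, zero_sub, Finset.mul_sum, Finset.sum_mul, Finset.sum_div,
    Finset.sum_neg_distrib]
  congr 1
  refine Finset.sum_congr rfl fun j _ => by ring

/-- This is `log (1 - z) ≥ -z - z²`: expand the exponential to second order for `z ≥ 0`, to first
order for `z ≤ 0`. At `z = 2l` it bounds the chi-square factor `(1 - 2l)^(-1/2)` by `exp (l + 2l²)`.
-/
theorem one_le_one_sub_mul_exp {z : ℝ} (h2 : z ≤ 1 / 2) :
    1 ≤ (1 - z) * Real.exp (z + z ^ 2) := by
  rcases le_total 0 z with hz | hz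
  · have h := Real.quadratic_le_exp_of_nonneg (x := z + z ^ 2) (by positivity)
    have h3 : (1 - z) * (1 + (z + z ^ 2) + (z + z ^ 2) ^ 2 / 2) ≤
        (1 - z) * Real.exp (z + z ^ 2) := mul_le_mul_of_nonneg_left h (by linarith)
    have h4 : 0 ≤ (1 - z) * (1 + z) ^ 2 / 2 - z := by
      nlinarith [mul_nonneg hz hz, mul_nonneg (mul_nonneg hz hz) (sub_nonneg.2 h2),
        mul_nonneg hz (sub_nonneg.2 h2)]
    nlinarith [mul_nonneg (sq_nonneg z) h4]
  · have h := Real.add_one_le_exp (z + z ^ 2)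
    have h3 : (1 - z) * (z + z ^ 2 + 1) ≤ (1 - z) * Real.exp (z + z ^ 2) :=
      mul_le_mul_of_nonneg_left h (by linarith)
    nlinarith [pow_nonneg (neg_nonneg.2 hz) 3]

/-- Exponential moments of the square of a centred Gaussian. -/
theorem exp_sq_gaussianReal {v : ℝ≥0} (hv : v ≠ 0) {l : ℝ} (hl : |l| ≤ 1 / 4) :
    Integrable (fun x : ℝ => Real.exp (l / v * x ^ 2)) (gaussianReal 0 v) ∧
      ∫ x, Real.exp (l / v * x ^ 2) ∂(gaussianReal 0 v) ≤ Real.exp (l + 2 * l ^ 2) := by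
  obtain ⟨hl1, hl2⟩ := abs_le.1 hl
  have hv0 : (0 : ℝ) < v := by positivity
  have hb : 0 < (1 - 2 * l) / (2 * v) := div_pos (by linarith) (by positivity)
  -- The tilted density is an unnormalised Gaussian density of variance `v / (1 - 2l)`.
  have key : ∀ x : ℝ, gaussianPDFReal 0 v x * Real.exp (l / v * x ^ 2) =
      (√(2 * Real.pi * v))⁻¹ * Real.exp (-((1 - 2 * l) / (2 * v)) * x ^ 2) := by
    intro x
    rw [gaussianPDFReal, mul_assoc, ← Real.exp_add]
    congr 2
    field_simp
    ring
  constructor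
  · rw [gaussianReal_of_var_ne_zero _ hv, gaussianPDF_def]
    rw [integrable_withDensity_iff_integrable_smul' (by fun_prop) (by simp)]
    refine ((integrable_exp_neg_mul_sq hb).const_mul (√(2 * Real.pi * v))⁻¹).congr ?_
    filter_upwards with x
    rw [← key, ENNReal.toReal_ofReal (gaussianPDFReal_nonneg _ _ _), smul_eq_mul]
  · rw [integral_gaussianReal_eq_integral_smul hv]
    simp_rw [smul_eq_mul, key]
    rw [integral_const_mul, integral_gaussian, ← Real.sqrt_inv, ← Real.sqrt_mul (by positivity)]
    have h1 : (2 * Real.pi * v)⁻¹ * (Real.pi / ((1 - 2 * l) / (2 * v))) = (1 - 2 * l)⁻¹ := by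
      have := Real.pi_pos
      have : 1 - 2 * l ≠ 0 := by linarith
      field_simp
    rw [h1]
    apply Real.sqrt_le_iff.2 ⟨by positivity, ?_⟩
    rw [← Real.exp_nat_mul, inv_le_iff_one_le_mul₀' (by linarith)]
    have := one_le_one_sub_mul_exp (z := 2 * l) (by linarith)
    rwa [show ((2 : ℕ) : ℝ) * (l + 2 * l ^ 2) = 2 * l + (2 * l) ^ 2 by push_cast; ring]

instance (t d : ℕ) : IsProbabilityMeasure (gaussianMatrix t d) :=
  Measure.isProbabilityMeasure_map
    (show Measurable fun x : Fin t → Fin d → ℝ => x from measurable_id).aemeasurable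

/-- The deviation of the squared norm of `S a` from its mean, times the number of rows. -/
noncomputable def sqDev {t d : ℕ} (a : Fin d → ℝ) (S : Matrix (Fin t) (Fin d) ℝ) : ℝ :=
  t * (‖(WithLp.toLp 2 (S *ᵥ a) : EuclideanSpace ℝ (Fin t))‖ ^ 2 -
    ‖(WithLp.toLp 2 a : EuclideanSpace ℝ (Fin d))‖ ^ 2)

theorem measurable_sqDev {t d : ℕ} (a : Fin d → ℝ) : Measurable (sqDev (t := t) a) := by
  have : sqDev (t := t) a = fun S : Fin t → Fin d → ℝ => t * (∑ i, (∑ j, S i j * a j) ^ 2 -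
      ‖(WithLp.toLp 2 a : EuclideanSpace ℝ (Fin d))‖ ^ 2) := by
    ext S
    rw [sqDev, EuclideanSpace.norm_sq_eq]
    simp [Matrix.mulVec, dotProduct]
  rw [this]
  exact show Measurable (fun S : Fin t → Fin d → ℝ => t * (∑ i, (∑ j, S i j * a j) ^ 2 -
      ‖(WithLp.toLp 2 a : EuclideanSpace ℝ (Fin d))‖ ^ 2)) by fun_prop

/-- Exponential moments of the squared norm of a Gaussian sketch of a unit vector. -/
theorem exp_sqDev {t d : ℕ} (ht : 0 < t) {a : Fin d → ℝ}
    (ha : ‖(WithLp.toLp 2 a : EuclideanSpace ℝ (Fin d))‖ = 1) {l : ℝ} (hl : |l| ≤ 1 / 4) :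
    Integrable (fun S => Real.exp (l * sqDev a S)) (gaussianMatrix t d) ∧
      ∫ S, Real.exp (l * sqDev a S) ∂(gaussianMatrix t d) ≤ Real.exp (2 * l ^ 2 * t) := by
  have hv : ((t : ℝ≥0)⁻¹) ≠ 0 := by positivity
  obtain ⟨hi, hb⟩ := exp_sq_gaussianReal hv hl
  have hna : ‖(WithLp.toLp 2 a : EuclideanSpace ℝ (Fin d))‖₊ = 1 := by ext; simpa using ha
  have hlaw := map_dotProduct_pi_gaussianReal (t : ℝ≥0)⁻¹ a
  rw [hna, one_pow, mul_one] at hlaw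
  have hm : Measurable (fun s : Fin d → ℝ => s ⬝ᵥ a) := by
    unfold dotProduct; fun_prop
  rw [← hlaw] at hi hb
  rw [integrable_map_measure (by fun_prop) hm.aemeasurable] at hi
  rw [integral_map hm.aemeasurable (by fun_prop)] at hb
  have hof : Measurable (Matrix.of : (Fin t → Fin d → ℝ) → Matrix (Fin t) (Fin d) ℝ) :=
    (show Measurable fun x : Fin t → Fin d → ℝ => x from measurable_id)
  have hme : Measurable (fun S : Matrix (Fin t) (Fin d) ℝ => Real.exp (l * sqDev a S)) :=
    Real.measurable_exp.comp ((measurable_sqDev a).const_mul l)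
  -- The rows are independent; the centring factor `exp (-lt)` will cancel the linear part of the
  -- `t` exponents `l + 2l²`.
  have hfac : ∀ S : Fin t → Fin d → ℝ, Real.exp (l * sqDev a (Matrix.of S)) =
      Real.exp (-(l * t)) * ∏ i, Real.exp (l / ((t : ℝ≥0)⁻¹ : ℝ≥0) * (S i ⬝ᵥ a) ^ 2) := by
    intro S
    rw [← Real.exp_sum, ← Real.exp_add, sqDev, ha, EuclideanSpace.norm_sq_eq]
    congr 1
    simp only [Matrix.mulVec, Matrix.of_apply, Real.norm_eq_abs, sq_abs, ← Finset.mul_sum,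
      NNReal.coe_inv, NNReal.coe_natCast, div_inv_eq_mul]
    ring
  rw [gaussianMatrix]
  constructor
  · rw [integrable_map_measure hme.aestronglyMeasurable hof.aemeasurable]
    refine Integrable.congr (Integrable.const_mul (Integrable.fintype_prod (f := fun _ s =>
      Real.exp (l / ((t : ℝ≥0)⁻¹ : ℝ≥0) * (s ⬝ᵥ a) ^ 2)) fun _ => hi) (Real.exp (-(l * t)))) ?_
    filter_upwards with S using (hfac S).symm
  · rw [integral_map hof.aemeasurable hme.aestronglyMeasurable]
    simp_rw [hfac]
    rw [integral_const_mul, integral_fintype_prod_eq_prod (fun _ s =>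
      Real.exp (l / ((t : ℝ≥0)⁻¹ : ℝ≥0) * (s ⬝ᵥ a) ^ 2)), Finset.prod_const, Finset.card_univ,
      Fintype.card_fin]
    calc _ ≤ Real.exp (-(l * t)) * Real.exp (l + 2 * l ^ 2) ^ t := by
          gcongr
      _ = _ := by
          rw [← Real.exp_nat_mul, ← Real.exp_add]
          congr 1
          ring

/-- Concentration of the squared norm of a Gaussian sketch of a unit vector. -/
theorem gaussianMatrix_sqDev_tail {t d : ℕ} (ht : 0 < t) {a : Fin d → ℝ}
    (ha : ‖(WithLp.toLp 2 a : EuclideanSpace ℝ (Fin d))‖ = 1) :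
    (gaussianMatrix t d).real {S | (t : ℝ) / 25 ≤ |sqDev a S|} ≤
      2 * Real.exp (-(t / 5000)) := by
  -- Chernoff at `l = ±1/100`: the exponent is `2t/100² - t/2500 = -t/5000`.
  have h1 := exp_sqDev ht ha (l := 1 / 100) (by rw [abs_of_pos] <;> norm_num)
  have h2 := exp_sqDev ht ha (l := -(1 / 100)) (by rw [abs_neg, abs_of_pos] <;> norm_num)
  have m1 := measure_ge_le_exp_mul_mgf (X := sqDev a) ((t : ℝ) / 25) (by norm_num) h1.1
  have m2 := measure_le_le_exp_mul_mgf (X := sqDev a) (-((t : ℝ) / 25)) (by norm_num) h2.1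
  have e : Real.exp (2 * (1 / 100) ^ 2 * t) * Real.exp (-(1 / 100) * (t / 25)) =
      Real.exp (-(t / 5000)) := by
    rw [← Real.exp_add]; congr 1; ring
  have b1 : (gaussianMatrix t d).real {S | (t : ℝ) / 25 ≤ sqDev a S} ≤
      Real.exp (-(t / 5000)) := by
    refine m1.trans ?_
    rw [← e, mul_comm]
    exact mul_le_mul_of_nonneg_right h1.2 (by positivity)
  have b2 : (gaussianMatrix t d).real {S | sqDev a S ≤ -((t : ℝ) / 25)} ≤
      Real.exp (-(t / 5000)) := by
    refine m2.trans ?_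
    rw [← e, mul_comm, show -(-(1 / 100)) * -((t : ℝ) / 25) = -(1 / 100) * (t / 25) by ring]
    refine mul_le_mul_of_nonneg_right (h2.2.trans_eq ?_) (by positivity)
    congr 1; ring
  have hsub : {S : Matrix (Fin t) (Fin d) ℝ | (t : ℝ) / 25 ≤ |sqDev a S|} ⊆
      {S | (t : ℝ) / 25 ≤ sqDev a S} ∪ {S | sqDev a S ≤ -((t : ℝ) / 25)} := by
    intro S hS
    simp only [Set.mem_union, Set.mem_ofPred_eq] at hS ⊢
    rcases le_abs.1 hS with h | h
    · exact Or.inl h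
    · exact Or.inr (by linarith)
  calc _ ≤ _ := measureReal_mono hsub
    _ ≤ _ := measureReal_union_le _ _
    _ ≤ _ := by linarith

/-- Second moment of the squared norm of a Gaussian sketch of a unit vector. -/
theorem integral_sqDev_sq {t d : ℕ} (ht : 0 < t) {a : Fin d → ℝ}
    (ha : ‖(WithLp.toLp 2 a : EuclideanSpace ℝ (Fin d))‖ = 1) :
    Integrable (fun S => sqDev a S ^ 2) (gaussianMatrix t d) ∧
      ∫ S, sqDev a S ^ 2 ∂(gaussianMatrix t d) ≤ 8 * t := by
  have ht1 : (1 : ℝ) ≤ t := by exact_mod_cast ht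
  have hs : 0 < √(t : ℝ) := by positivity
  have hs1 : 1 ≤ √(t : ℝ) := Real.one_le_sqrt.2 ht1
  have hss : √(t : ℝ) ^ 2 = t := Real.sq_sqrt (by positivity)
  -- At this scale `l² t = 1/16`, so both exponential moments are at most `exp (1/8)`, independently
  -- of `t`.
  set l : ℝ := 1 / (4 * √(t : ℝ)) with hl
  have hl0 : 0 < l := by positivity
  have hl4 : l ≤ 1 / 4 := by
    rw [hl]; apply one_div_le_one_div_of_le <;> linarith
  have hl2 : l ^ 2 * t = 1 / 16 := by
    rw [hl, div_pow, mul_pow, hss]; field_simp; norm_num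
  have h1 := exp_sqDev ht ha (l := l) (by rwa [abs_of_pos hl0])
  have h2 := exp_sqDev ht ha (l := -l) (by rwa [abs_neg, abs_of_pos hl0])
  -- `2 cosh z - 2 = 4 sinh² (z/2) ≥ z²`.
  have hpt : ∀ z : ℝ, z ^ 2 + 2 ≤ Real.exp z + Real.exp (-z) := by
    intro z
    have h1 : (z / 2) ^ 2 ≤ Real.sinh (z / 2) ^ 2 := by
      rcases le_total 0 z with hz | hz
      · have : z / 2 ≤ Real.sinh (z / 2) := Real.self_le_sinh_iff.2 (by linarith)
        gcongr
      · have : Real.sinh (z / 2) ≤ z / 2 := Real.sinh_le_self_iff.2 (by linarith)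
        nlinarith
    have h2 := Real.cosh_two_mul (z / 2)
    rw [Real.cosh_sq, mul_div_cancel₀ _ (two_ne_zero), Real.cosh_eq] at h2
    linarith
  have hpt' : ∀ S : Matrix (Fin t) (Fin d) ℝ, sqDev a S ^ 2 ≤
      16 * t * (Real.exp (l * sqDev a S) + Real.exp (-l * sqDev a S) - 2) := by
    intro S
    have := hpt (l * sqDev a S)
    rw [mul_pow, ← neg_mul] at this
    have h16 : (16 : ℝ) * t * l ^ 2 = 1 := by linarith
    calc sqDev a S ^ 2 = 16 * t * (l ^ 2 * sqDev a S ^ 2) := by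
          rw [← mul_assoc, h16, one_mul]
      _ ≤ _ := by gcongr; linarith
  have hint : Integrable (fun S => 16 * t * (Real.exp (l * sqDev a S) +
      Real.exp (-l * sqDev a S) - 2)) (gaussianMatrix t d) :=
    ((h1.1.add h2.1).sub (integrable_const 2)).const_mul _
  have hi : Integrable (fun S => sqDev a S ^ 2) (gaussianMatrix t d) := by
    refine hint.mono' ((measurable_sqDev a).pow_const 2).aestronglyMeasurable ?_
    filter_upwards with S
    rw [Real.norm_eq_abs, abs_of_nonneg (sq_nonneg _)]
    exact hpt' S
  refine ⟨hi, (integral_mono hi hint hpt').trans ?_⟩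
  have hadd : Integrable (fun S => Real.exp (l * sqDev a S) + Real.exp (-l * sqDev a S))
      (gaussianMatrix t d) := h1.1.add h2.1
  rw [integral_const_mul, integral_sub hadd (integrable_const 2),
    integral_add h1.1 h2.1, integral_const]
  have e1 : Real.exp (2 * l ^ 2 * t) ≤ 1 + 1 / 4 := by
    rw [show 2 * l ^ 2 * t = 1 / 8 by linarith]
    have := Real.exp_bound_div_one_sub_of_interval (x := 1 / 8) (by norm_num) (by norm_num)
    linarith
  have e2 := h2.2
  rw [neg_sq] at e2
  simp only [probReal_univ, one_smul]
  have : ∫ S, Real.exp (l * sqDev a S) ∂(gaussianMatrix t d) +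
    ∫ S, Real.exp (-l * sqDev a S) ∂(gaussianMatrix t d) - 2 ≤ 1 / 2 := by linarith [h1.2]
  calc _ ≤ 16 * (t : ℝ) * (1 / 2) := by gcongr
    _ = _ := by ring

/-! ### Nets and operator norms. -/

section Net

variable {E : Type*} [NormedAddCommGroup E] [NormedSpace ℝ E]

/-- The ball of radius `2` of a normed space of dimension `k` has a `1`-net with at most `5 ^ k`
points. -/
theorem exists_net (E : Type*) [NormedAddCommGroup E] [NormedSpace ℝ E] [FiniteDimensional ℝ E] :
    ∃ N : Finset E, N.card ≤ 5 ^ Module.finrank ℝ E ∧ (∀ c ∈ N, ‖c‖ ≤ 2) ∧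
      ∀ x, ‖x‖ ≤ 2 → ∃ c ∈ N, ‖x - c‖ ≤ 1 := by
  classical
  -- A `1`-separated set of maximal size is a net, since a point at distance more than `1` from all
  -- of it could be added.
  let P : ℕ → Prop := fun m => ∃ s : Finset E, s.card = m ∧ (∀ c ∈ s, ‖c‖ ≤ 2) ∧
    ∀ c ∈ s, ∀ d ∈ s, c ≠ d → 1 ≤ ‖c - d‖
  have hP : ∀ m, P m → m ≤ 5 ^ Module.finrank ℝ E := by
    rintro m ⟨s, rfl, h1, h2⟩
    exact Besicovitch.card_le_of_separated s h1 h2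
  obtain ⟨N, hN, h1, h2⟩ : P (Nat.findGreatest P (5 ^ Module.finrank ℝ E)) :=
    Nat.findGreatest_spec (m := 0) (Nat.zero_le _) ⟨∅, by simp⟩
  refine ⟨N, by rw [hN]; exact Nat.findGreatest_le _, h1, fun x hx => ?_⟩
  by_contra! hcon
  have hxN : x ∉ N := fun h => by simpa using (hcon x h).trans_le' zero_le_one
  have hbig : P (N.card + 1) := by
    refine ⟨insert x N, Finset.card_insert_of_notMem hxN, ?_, ?_⟩
    · simpa using ⟨hx, h1⟩
    · intro c hc d hd hcd
      rcases Finset.mem_insert.1 hc with rfl | hc' <;> rcases Finset.mem_insert.1 hd with rfl | hd'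
      · exact absurd rfl hcd
      · exact (hcon d hd').le
      · rw [norm_sub_rev]; exact (hcon c hc').le
      · exact h2 c hc' d hd' hcd
  have := Nat.le_findGreatest (hP _ hbig) hbig
  omega

/-- A vector of norm `2` is a net point plus an error of norm at most `1`, whence `2‖f‖ ≤ τ + ‖f‖`.
-/
theorem opNorm_le_of_net {G : Type*} [NormedAddCommGroup G] [NormedSpace ℝ G] {N : Set E}
    (hN : ∀ x, ‖x‖ ≤ 2 → ∃ c ∈ N, ‖x - c‖ ≤ 1) (f : E →L[ℝ] G) {τ : ℝ} (hτ : 0 ≤ τ)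
    (hf : ∀ c ∈ N, ‖f c‖ ≤ τ) : ‖f‖ ≤ τ := by
  have key : ‖f‖ ≤ (τ + ‖f‖) / 2 := by
    refine f.opNorm_le_bound (by positivity) fun x => ?_
    rcases eq_or_ne x 0 with rfl | hx
    · simp
    have hx0 : 0 < ‖x‖ := norm_pos_iff.2 hx
    obtain ⟨c, hc, hxc⟩ := hN ((2 / ‖x‖) • x) (by
      rw [norm_smul, Real.norm_of_nonneg (by positivity), div_mul_cancel₀ _ hx0.ne'])
    have h1 : ‖f ((2 / ‖x‖) • x)‖ ≤ τ + ‖f‖ := by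
      calc _ = ‖f c + f ((2 / ‖x‖) • x - c)‖ := by rw [← map_add, add_sub_cancel]
        _ ≤ ‖f c‖ + ‖f ((2 / ‖x‖) • x - c)‖ := norm_add_le _ _
        _ ≤ τ + ‖f‖ * 1 := add_le_add (hf c hc) (f.le_opNorm_of_le hxc)
        _ = _ := by ring
    rw [map_smul, norm_smul, Real.norm_of_nonneg (by positivity), div_mul_eq_mul_div,
      div_le_iff₀ hx0] at h1
    linarith
  linarith

end Net

/-! ### Deterministic conditions under which a linear map preserves sums of distances to a subspace.
-/

section Sketch

variable {E G : Type*} [NormedAddCommGroup E] [InnerProductSpace ℝ E]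
  [NormedAddCommGroup G] [InnerProductSpace ℝ G]

/-- Polarization on the left, the parallelogram law on the right. -/
theorem abs_inner_map_sub_inner_le (T : E →ₗ[ℝ] G) {x y : E} {ε : ℝ}
    (h1 : |‖T (x + y)‖ ^ 2 - ‖x + y‖ ^ 2| ≤ ε * ‖x + y‖ ^ 2)
    (h2 : |‖T (x - y)‖ ^ 2 - ‖x - y‖ ^ 2| ≤ ε * ‖x - y‖ ^ 2) :
    |inner ℝ (T x) (T y) - inner ℝ x y| ≤ ε / 2 * (‖x‖ ^ 2 + ‖y‖ ^ 2) := by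
  rw [abs_le] at *
  rw [map_add, norm_add_sq_real (T x), norm_add_sq_real x] at h1
  rw [map_sub, norm_sub_sq_real (T x), norm_sub_sq_real x] at h2
  constructor <;> linarith

/-- A linear map that nearly preserves the norms of sums and differences of points of a net is
nearly isometric. -/
theorem abs_norm_sq_sub_le_of_net [FiniteDimensional ℝ E] {N : Set E} (hN2 : ∀ c ∈ N, ‖c‖ ≤ 2)
    (hN : ∀ x, ‖x‖ ≤ 2 → ∃ c ∈ N, ‖x - c‖ ≤ 1) (T : E →ₗ[ℝ] G) {ε : ℝ} (hε : 0 ≤ ε)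
    (h : ∀ x ∈ N, ∀ y ∈ N, |‖T (x + y)‖ ^ 2 - ‖x + y‖ ^ 2| ≤ ε * ‖x + y‖ ^ 2 ∧
      |‖T (x - y)‖ ^ 2 - ‖x - y‖ ^ 2| ≤ ε * ‖x - y‖ ^ 2) (v : E) :
    |‖T v‖ ^ 2 - ‖v‖ ^ 2| ≤ 4 * ε * ‖v‖ ^ 2 := by
  -- The defect of isometry is a bilinear form, and the net bound is applied in each argument. Net
  -- points have norm at most `2`, so its values there are at most `ε/2 * (4 + 4)`.
  let B : E →L[ℝ] E →L[ℝ] ℝ :=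
    (innerSL ℝ).bilinearComp T.toContinuousLinearMap T.toContinuousLinearMap - innerSL ℝ
  have hB : ∀ x y, B x y = inner ℝ (T x) (T y) - inner ℝ x y := fun x y => rfl
  have hBn : ‖B‖ ≤ 4 * ε := by
    refine opNorm_le_of_net hN B (by positivity) fun x hx =>
      opNorm_le_of_net hN (B x) (by positivity) fun y hy => ?_
    rw [hB, Real.norm_eq_abs]
    refine (abs_inner_map_sub_inner_le T (h x hx y hy).1 (h x hx y hy).2).trans ?_
    have h1 : ‖x‖ ^ 2 ≤ 2 ^ 2 := by gcongr; exact hN2 x hx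
    have h2 : ‖y‖ ^ 2 ≤ 2 ^ 2 := by gcongr; exact hN2 y hy
    nlinarith
  have := B.le_opNorm₂ v v
  rw [hB, real_inner_self_eq_norm_sq, real_inner_self_eq_norm_sq, Real.norm_eq_abs] at this
  calc _ ≤ _ := this
    _ ≤ 4 * ε * ‖v‖ * ‖v‖ := by gcongr
    _ = _ := by ring

/-- How much a linear map `T` fails to keep a vector `u`, orthogonal to the orthonormal family `w`,
orthogonal to that family and of the same length. -/
noncomputable def sketchErr {ι : Type*} [Fintype ι] (T : E →ₗ[ℝ] G) (w : ι → E) (u : E) : ℝ :=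
  ∑ j, inner ℝ (T (w j)) (T u) ^ 2 + (‖T u‖ ^ 2 - ‖u‖ ^ 2) ^ 2 / 2

theorem sketchErr_nonneg {ι : Type*} [Fintype ι] (T : E →ₗ[ℝ] G) (w : ι → E) (u : E) :
    0 ≤ sketchErr T w u := by unfold sketchErr; positivity

/-- Cauchy–Schwarz in the coordinates of `v`. The right-hand sum does not involve `v`, which makes
the estimate uniform over `K`. -/
theorem sq_inner_map_le {ι : Type*} [Fintype ι] {K : Submodule ℝ E} (T : E →ₗ[ℝ] G)
    (w : OrthonormalBasis ι ℝ K) {v : E} (hv : v ∈ K) (u : E) :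
    inner ℝ (T v) (T u) ^ 2 ≤ ‖v‖ ^ 2 * ∑ j, inner ℝ (T (w j)) (T u) ^ 2 := by
  have h1 : v = ∑ j, inner ℝ (w j) (⟨v, hv⟩ : K) • (w j : E) := by
    have := congrArg (Subtype.val) (w.sum_repr' ⟨v, hv⟩)
    simpa using this.symm
  have h2 : ‖v‖ ^ 2 = ∑ j, inner ℝ (w j) (⟨v, hv⟩ : K) ^ 2 := by
    have := w.sum_sq_norm_inner_right ⟨v, hv⟩
    simpa using this.symm
  have h3 : inner ℝ (T v) (T u) =
      ∑ j, inner ℝ (w j) (⟨v, hv⟩ : K) * inner ℝ (T (w j)) (T u) := by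
    conv_lhs => rw [h1]
    simp only [map_sum, map_smul, sum_inner, real_inner_smul_left]
  rw [h2, h3]
  exact Finset.sum_mul_sq_le_sq_mul_sq _ _ _

theorem norm_map_add_smul_ge {ι : Type*} [Fintype ι] {K : Submodule ℝ E} (T : E →ₗ[ℝ] G)
    (w : OrthonormalBasis ι ℝ K) (hT : ∀ v ∈ K, 81 / 100 * ‖v‖ ^ 2 ≤ ‖T v‖ ^ 2)
    {v u : E} (hv : v ∈ K) (hu : u ∈ Kᗮ) (hu1 : ‖u‖ = 1) {ρ : ℝ} (hρ : 0 ≤ ρ) :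
    9 / 10 * ‖v + ρ • u‖ - (1 / 20 + 40 * sketchErr T (fun j => (w j : E)) u) * ρ ≤
      ‖T (v + ρ • u)‖ := by
  have hD : ‖v + ρ • u‖ ^ 2 = ‖v‖ ^ 2 + ρ ^ 2 := by
    rw [norm_add_sq_real, real_inner_smul_right, hu v hv, norm_smul, hu1, Real.norm_of_nonneg hρ]
    ring
  have hA : ‖T (v + ρ • u)‖ ^ 2 =
      ‖T v‖ ^ 2 + 2 * ρ * inner ℝ (T v) (T u) + ρ ^ 2 * ‖T u‖ ^ 2 := by
    rw [map_add, map_smul, norm_add_sq_real, real_inner_smul_right, norm_smul,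
      Real.norm_of_nonneg hρ]
    ring
  have hI := sq_inner_map_le T w hv u
  set τ := sketchErr T (fun j => (w j : E)) u with hτ
  have hτ0 : 0 ≤ τ := sketchErr_nonneg _ _ _
  rw [sketchErr, hu1, one_pow] at hτ
  set g := ∑ j, inner ℝ (T (w j)) (T u) ^ 2
  have hg : 0 ≤ g := Finset.sum_nonneg fun _ _ => sq_nonneg _
  set D := ‖v + ρ • u‖
  set a := ‖T (v + ρ • u)‖
  have hD0 : 0 ≤ D := norm_nonneg _
  have ha0 : 0 ≤ a := norm_nonneg _
  have hvD : ‖v‖ ≤ D := le_of_sq_le_sq (by nlinarith) hD0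
  have hρD : ρ ≤ D := le_of_sq_le_sq (by nlinarith [sq_nonneg ‖v‖]) hD0
  have hs : √g ^ 2 = g := Real.sq_sqrt hg
  have hs0 := Real.sqrt_nonneg g
  have hIn : -(D * √g) ≤ inner ℝ (T v) (T u) := by
    have : |inner ℝ (T v) (T u)| ≤ ‖v‖ * √g :=
      abs_le_of_sq_le_sq (by rw [mul_pow, hs]; exact hI) (by positivity)
    have := (abs_le.1 this).1
    nlinarith
  set δ := ‖T u‖ ^ 2 - 1 with hδ
  -- `x ≤ s/2 + x²/(2s)` with `s = 3/100`. The cross term enters twice and `δ` once, which explains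
  -- the weight `1/2` in `sketchErr`.
  have hg1 : √g ≤ 3 / 200 + g / (3 / 50) := by
    nlinarith [sq_nonneg (√g - 3 / 100)]
  have hd1 : -δ ≤ 3 / 200 + δ ^ 2 / (3 / 50) := by nlinarith [sq_nonneg (δ + 3 / 100)]
  have hmain : 81 / 100 * D ^ 2 - ρ * D * (9 / 200 + τ / (3 / 100)) ≤ a ^ 2 := by
    have e1 : 2 * ρ * -(D * √g) ≤ 2 * ρ * inner ℝ (T v) (T u) := by gcongr
    have e2 : ρ * (D * √g) ≤ ρ * (D * (3 / 200 + g / (3 / 50))) := by gcongr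
    have e3 : ρ * ρ * -δ ≤ ρ * D * (3 / 200 + δ ^ 2 / (3 / 50)) := by
      calc _ ≤ ρ * ρ * (3 / 200 + δ ^ 2 / (3 / 50)) := by gcongr
        _ ≤ _ := by gcongr
    have e4 : ‖T u‖ ^ 2 = 1 + δ := by rw [hδ]; ring
    rw [hA, hD, e4, hτ]
    nlinarith [hT v hv]
  -- Under the negation the right side is positive, so it may be squared; the contradiction comes
  -- from `9/10 * (1/20 + 40τ) = 9/200 + 36τ ≥ 9/200 + τ/(3/100)`.
  by_contra! hlt
  set κ := 1 / 20 + 40 * τ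
  have h1 : a ^ 2 < (9 / 10 * D - κ * ρ) ^ 2 := by gcongr
  have h2 : 0 ≤ κ * ρ := by positivity
  have h3 : (9 / 10 * D - κ * ρ) ^ 2 ≤ 81 / 100 * D ^ 2 - 9 / 10 * D * (κ * ρ) := by nlinarith
  have h4 : ρ * D * (9 / 200 + τ / (3 / 100)) ≤ ρ * D * (9 / 10 * κ) := by
    gcongr
    simp only [κ]; linarith
  nlinarith

theorem norm_map_le_of_sketchErr {ι : Type*} [Fintype ι] (T : E →ₗ[ℝ] G) (w : ι → E) {u : E}
    (hu1 : ‖u‖ = 1) : ‖T u‖ ≤ 1 + (1 / 20 + 40 * sketchErr T w u) := by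
  have h : (‖T u‖ ^ 2 - 1) ^ 2 / 2 ≤ sketchErr T w u := by
    rw [sketchErr, hu1, one_pow]
    have : 0 ≤ ∑ j, inner ℝ (T (w j)) (T u) ^ 2 := Finset.sum_nonneg fun _ _ => sq_nonneg _
    linarith
  nlinarith [sq_nonneg (‖T u‖ ^ 2 - 1 - 3 / 100), norm_nonneg (T u), sq_nonneg (‖T u‖ - 1)]

/-- If the errors of the directions `r i` orthogonal to `K` are small on average, then `T`
does not contract sums of distances to `K` by much. -/
theorem sum_norm_map_ge {ι κ : Type*} [Fintype ι] [Fintype κ] {K : Submodule ℝ E} (T : E →ₗ[ℝ] G)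
    (w : OrthonormalBasis ι ℝ K) (hT : ∀ v ∈ K, 81 / 100 * ‖v‖ ^ 2 ≤ ‖T v‖ ^ 2)
    {r : κ → E} (hr : ∀ i, r i ∈ Kᗮ)
    (hs : ∑ i, ‖r i‖ * sketchErr T (fun j => (w j : E)) (‖r i‖⁻¹ • r i) ≤
      1 / 1000 * ∑ i, ‖r i‖) :
    (∀ v : κ → E, (∀ i, v i ∈ K) → 4 / 5 * ∑ i, ‖v i + r i‖ ≤ ∑ i, ‖T (v i + r i)‖) ∧
      ∑ i, ‖T (r i)‖ ≤ 6 / 5 * ∑ i, ‖r i‖ := by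
  set τ : κ → ℝ := fun i => sketchErr T (fun j => (w j : E)) (‖r i‖⁻¹ • r i)
  have hunit : ∀ i, r i ≠ 0 → ‖‖r i‖⁻¹ • r i‖ = 1 := fun i hi => norm_smul_inv_norm (𝕜 := ℝ) hi
  have hback : ∀ i, r i ≠ 0 → r i = ‖r i‖ • (‖r i‖⁻¹ • r i) := fun i hi => by
    rw [smul_smul, mul_inv_cancel₀ (norm_ne_zero_iff.2 hi), one_smul]
  -- The total loss is `1/20 + 40/1000 = 9/100`, within the slack of both `9/10 - 9/100 ≥ 4/5` and
  -- `1 + 9/100 ≤ 6/5`.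
  have htot : ∑ i, (1 / 20 + 40 * τ i) * ‖r i‖ ≤ 9 / 100 * ∑ i, ‖r i‖ := by
    have : ∑ i, (1 / 20 + 40 * τ i) * ‖r i‖ =
        1 / 20 * ∑ i, ‖r i‖ + 40 * ∑ i, ‖r i‖ * τ i := by
      rw [Finset.mul_sum, Finset.mul_sum, ← Finset.sum_add_distrib]
      exact Finset.sum_congr rfl fun i _ => by ring
    linarith
  constructor
  · intro v hv
    have h1 : ∀ i, 9 / 10 * ‖v i + r i‖ - (1 / 20 + 40 * τ i) * ‖r i‖ ≤ ‖T (v i + r i)‖ := by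
      intro i
      rcases eq_or_ne (r i) 0 with h0 | h0
      · have h2 := hT (v i) (hv i)
        rw [h0]
        simp only [add_zero, norm_zero, mul_zero, sub_zero]
        refine le_of_sq_le_sq ?_ (norm_nonneg _)
        rw [mul_pow]; linarith
      · have := norm_map_add_smul_ge T w hT (hv i) (Kᗮ.smul_mem (‖r i‖⁻¹) (hr i)) (hunit i h0)
          (norm_nonneg (r i))
        rwa [← hback i h0] at this
    have h2 := Finset.sum_le_sum fun i (_ : i ∈ Finset.univ) => h1 i
    rw [Finset.sum_sub_distrib, ← Finset.mul_sum] at h2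
    have h3 : ∑ i, ‖r i‖ ≤ ∑ i, ‖v i + r i‖ := by
      refine Finset.sum_le_sum fun i _ => le_of_sq_le_sq ?_ (norm_nonneg _)
      rw [norm_add_sq_real, hr i (v i) (hv i)]
      nlinarith [sq_nonneg ‖v i‖]
    have h4 : 0 ≤ ∑ i, ‖r i‖ := Finset.sum_nonneg fun _ _ => norm_nonneg _
    linarith
  · have h1 : ∀ i, ‖T (r i)‖ ≤ ‖r i‖ + (1 / 20 + 40 * τ i) * ‖r i‖ := by
      intro i
      rcases eq_or_ne (r i) 0 with h0 | h0
      · rw [h0]; simp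
      · have := norm_map_le_of_sketchErr T (fun j => (w j : E)) (hunit i h0)
        conv_lhs => rw [hback i h0]
        rw [map_smul, norm_smul, norm_norm]
        calc _ ≤ ‖r i‖ * (1 + (1 / 20 + 40 * τ i)) := by gcongr
          _ = _ := by ring
    have h2 := Finset.sum_le_sum fun i (_ : i ∈ Finset.univ) => h1 i
    rw [Finset.sum_add_distrib] at h2
    have : 0 ≤ ∑ i, ‖r i‖ := Finset.sum_nonneg fun _ _ => norm_nonneg _
    linarith

end Sketch

/-! ### Gaussian matrices satisfy these conditions with high probability. -/

theorem sqDev_ofLp {t d : ℕ} (v : EuclideanSpace ℝ (Fin d)) (S : Matrix (Fin t) (Fin d) ℝ) :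
    sqDev v.ofLp S = t * (‖Matrix.toEuclideanLin S v‖ ^ 2 - ‖v‖ ^ 2) := rfl

theorem sqDev_smul {t d : ℕ} (c : ℝ) (v : EuclideanSpace ℝ (Fin d))
    (S : Matrix (Fin t) (Fin d) ℝ) :
    sqDev (c • v).ofLp S = c ^ 2 * (t * (‖Matrix.toEuclideanLin S v‖ ^ 2 - ‖v‖ ^ 2)) := by
  rw [sqDev_ofLp, map_smul, norm_smul, norm_smul, mul_pow, mul_pow, Real.norm_eq_abs, sq_abs]
  ring

/-- Rescaling to a unit vector; the strict inequality makes the event empty at `v = 0`. -/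
theorem gaussianMatrix_norm_sq_tail {t d : ℕ} (ht : 0 < t) (v : EuclideanSpace ℝ (Fin d)) :
    (gaussianMatrix t d).real {S | 1 / 25 * ‖v‖ ^ 2 <
      |‖Matrix.toEuclideanLin S v‖ ^ 2 - ‖v‖ ^ 2|} ≤ 2 * Real.exp (-(t / 5000)) := by
  rcases eq_or_ne v 0 with rfl | hv
  · simp; positivity
  refine le_trans (measureReal_mono ?_)
    (gaussianMatrix_sqDev_tail (a := (‖v‖⁻¹ • v).ofLp) ht (norm_smul_inv_norm (𝕜 := ℝ) hv))
  intro S hS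
  simp only [Set.mem_ofPred_eq] at hS ⊢
  have hv0 : 0 < ‖v‖ := norm_pos_iff.2 hv
  rw [sqDev_smul, abs_mul, abs_mul, Nat.abs_cast, abs_of_nonneg (by positivity), inv_pow]
  rw [inv_mul_eq_div, le_div_iff₀ (by positivity)]
  have : (t : ℝ) * (1 / 25 * ‖v‖ ^ 2) ≤ t * |‖Matrix.toEuclideanLin S v‖ ^ 2 - ‖v‖ ^ 2| := by
    gcongr
  linarith

/-- The numerics of the union bound: at most `25 ^ k` pairs of net points, each with two events of
probability at most `2 exp (-t/5000)`, against `t/5000 ≥ 200 k`. -/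
theorem exp_tail_small {k t : ℕ} (hk : 1 ≤ k) (ht : 1000000 * (k : ℝ) ≤ t) :
    25 ^ k * (4 * Real.exp (-(t / 5000))) ≤ 1 / 20 := by
  have h1 : Real.exp (-(t / 5000)) ≤ Real.exp (-200) ^ k := by
    rw [← Real.exp_nat_mul]
    apply Real.exp_le_exp.2
    linarith
  have h2 : Real.exp (-200) ≤ 1 / 20000 := by
    rw [Real.exp_neg, one_div]
    have := Real.quadratic_le_exp_of_nonneg (x := 200) (by norm_num)
    gcongr
    linarith
  have h3 : (25 * Real.exp (-200)) ^ k ≤ 1 / 80 := by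
    calc _ ≤ (1 / 80 : ℝ) ^ k := by gcongr; linarith
      _ ≤ (1 / 80) ^ 1 := pow_le_pow_of_le_one (by norm_num) (by norm_num) hk
      _ = _ := pow_one _
  rw [mul_pow] at h3
  have : (25 : ℝ) ^ k * Real.exp (-(t / 5000)) ≤ 25 ^ k * Real.exp (-200) ^ k := by gcongr
  linarith

/-- A Gaussian matrix with `O(k)` rows does not contract the vectors of a `k`-dimensional space
by much. -/
theorem gaussianMatrix_subspace_embedding {d k t : ℕ} (hk : 1 ≤ k)
    (ht : 1000000 * (k : ℝ) ≤ t) (K : Submodule ℝ (EuclideanSpace ℝ (Fin d)))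
    (hK : Module.finrank ℝ K ≤ k) :
    (gaussianMatrix t d).real
      {S | ∀ v ∈ K, 81 / 100 * ‖v‖ ^ 2 ≤ ‖Matrix.toEuclideanLin S v‖ ^ 2}ᶜ ≤ 1 / 20 := by
  classical
  have hk1 : (1 : ℝ) ≤ k := by exact_mod_cast hk
  have ht0 : 0 < t := by
    have : (0 : ℝ) < t := by linarith
    exact_mod_cast this
  obtain ⟨N, hcard, hN2, hN⟩ := exists_net K
  let bad : EuclideanSpace ℝ (Fin d) → Set (Matrix (Fin t) (Fin d) ℝ) := fun v =>
    {S | 1 / 25 * ‖v‖ ^ 2 < |‖Matrix.toEuclideanLin S v‖ ^ 2 - ‖v‖ ^ 2|}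
  have hsub : {S : Matrix (Fin t) (Fin d) ℝ |
      ∀ v ∈ K, 81 / 100 * ‖v‖ ^ 2 ≤ ‖Matrix.toEuclideanLin S v‖ ^ 2}ᶜ ⊆
      ⋃ p ∈ N ×ˢ N, bad ((p.1 + p.2 : K) : EuclideanSpace ℝ (Fin d)) ∪
        bad ((p.1 - p.2 : K) : EuclideanSpace ℝ (Fin d)) := by
    intro S hS
    contrapose! hS
    simp only [Set.mem_iUnion, not_exists, Set.mem_union, not_or, bad, Set.mem_ofPred_eq,
      not_lt, Finset.mem_product, and_imp, Prod.forall] at hS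
    simp only [Set.mem_compl_iff, Set.mem_ofPred_eq, not_not]
    intro v hv
    -- The net argument turns `1/25` into `4/25`, and `1 - 4/25 ≥ 81/100`.
    have := abs_norm_sq_sub_le_of_net (N := (N : Set K)) hN2 hN
      ((Matrix.toEuclideanLin S).domRestrict K) (ε := 1 / 25) (by norm_num)
      (fun x hx y hy => hS x y hx hy) ⟨v, hv⟩
    have h2 := (abs_le.1 this).1
    simp only [LinearMap.domRestrict_apply, Submodule.coe_norm] at h2
    nlinarith [sq_nonneg ‖v‖]
  calc _ ≤ _ := measureReal_mono hsub (measure_ne_top _ _)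
    _ ≤ ∑ p ∈ N ×ˢ N, (gaussianMatrix t d).real
        (bad ((p.1 + p.2 : K) : EuclideanSpace ℝ (Fin d)) ∪
          bad ((p.1 - p.2 : K) : EuclideanSpace ℝ (Fin d))) := measureReal_biUnion_finset_le _ _
    _ ≤ ∑ p ∈ N ×ˢ N, 4 * Real.exp (-(t / 5000)) := by
        refine Finset.sum_le_sum fun p _ => (measureReal_union_le _ _).trans ?_
        have h1 := gaussianMatrix_norm_sq_tail ht0 ((p.1 + p.2 : K) : EuclideanSpace ℝ (Fin d))
        have h2 := gaussianMatrix_norm_sq_tail ht0 ((p.1 - p.2 : K) : EuclideanSpace ℝ (Fin d))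
        linarith
    _ = ((N.card : ℝ) * N.card) * (4 * Real.exp (-(t / 5000))) := by
        rw [Finset.sum_const, Finset.card_product, nsmul_eq_mul]; push_cast; ring
    _ ≤ 25 ^ k * (4 * Real.exp (-(t / 5000))) := by
        have : (N.card : ℝ) ≤ 5 ^ k := by
          calc (N.card : ℝ) ≤ 5 ^ Module.finrank ℝ K := by exact_mod_cast hcard
            _ ≤ 5 ^ k := pow_le_pow_right₀ (by norm_num) hK
        gcongr
        calc _ ≤ (5 : ℝ) ^ k * 5 ^ k := by gcongr
          _ = _ := by rw [← mul_pow]; norm_num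
    _ ≤ _ := exp_tail_small hk ht

/-- The expected error of a Gaussian sketch in a direction orthogonal to a subspace. -/
theorem exists_sketchErr_bound {d t : ℕ} (ht : 0 < t) {ι : Type*} [Fintype ι]
    {w : ι → EuclideanSpace ℝ (Fin d)} {u : EuclideanSpace ℝ (Fin d)}
    (hw : ∀ j, ‖w j‖ = 1) (hu : ‖u‖ = 1) (hwu : ∀ j, inner ℝ (w j) u = 0) :
    ∃ F : Matrix (Fin t) (Fin d) ℝ → ℝ, Integrable F (gaussianMatrix t d) ∧
      (∀ S, sketchErr (Matrix.toEuclideanLin S) w u ≤ F S) ∧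
      ∫ S, F S ∂(gaussianMatrix t d) ≤ (8 * Fintype.card ι + 4) / t := by
  have ht0 : (0 : ℝ) < t := by exact_mod_cast ht
  -- Since `w j` and `u` are orthonormal, `(w j ± u)/√2` are unit vectors, and the cross term `⟨S (w
  -- j), S u⟩` is half the difference of their squared images; second moments of `sqDev` therefore
  -- control it.
  let p : ι → EuclideanSpace ℝ (Fin d) := fun j => (√2)⁻¹ • (w j + u)
  let m : ι → EuclideanSpace ℝ (Fin d) := fun j => (√2)⁻¹ • (w j - u)
  have h2 : (√2 : ℝ) ^ 2 = 2 := Real.sq_sqrt (by norm_num)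
  have hnp : ∀ j, ‖w j + u‖ ^ 2 = 2 := fun j => by
    rw [norm_add_sq_real, hw, hu, hwu]; norm_num
  have hnm : ∀ j, ‖w j - u‖ ^ 2 = 2 := fun j => by
    rw [norm_sub_sq_real, hw, hu, hwu]; norm_num
  have hp : ∀ j, ‖p j‖ = 1 := fun j => by
    rw [← sq_eq_sq₀ (norm_nonneg _) zero_le_one, norm_smul, mul_pow, hnp, Real.norm_eq_abs, sq_abs,
      inv_pow, h2]
    norm_num
  have hm : ∀ j, ‖m j‖ = 1 := fun j => by
    rw [← sq_eq_sq₀ (norm_nonneg _) zero_le_one, norm_smul, mul_pow, hnm, Real.norm_eq_abs, sq_abs,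
      inv_pow, h2]
    norm_num
  have ip := fun j => integral_sqDev_sq (a := (p j).ofLp) ht (hp j)
  have im := fun j => integral_sqDev_sq (a := (m j).ofLp) ht (hm j)
  have iu := integral_sqDev_sq (a := u.ofLp) ht hu
  have ipm : ∀ j, Integrable (fun S => sqDev (p j).ofLp S ^ 2 + sqDev (m j).ofLp S ^ 2)
      (gaussianMatrix t d) := fun j => (ip j).1.add (im j).1
  have hint : Integrable (fun S => ∑ j, (sqDev (p j).ofLp S ^ 2 + sqDev (m j).ofLp S ^ 2))
      (gaussianMatrix t d) := integrable_finsetSum _ fun j _ => ipm j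
  -- An integrable majorant is enough for Markov's inequality and spares the measurability of
  -- `sketchErr`.
  refine ⟨fun S => (2 * t ^ 2 : ℝ)⁻¹ *
    (∑ j, (sqDev (p j).ofLp S ^ 2 + sqDev (m j).ofLp S ^ 2) + sqDev u.ofLp S ^ 2),
    (hint.add iu.1).const_mul _, fun S => ?_, ?_⟩
  · beta_reduce
    rw [inv_mul_eq_div, le_div_iff₀ (by positivity), sketchErr, add_mul, Finset.sum_mul]
    refine add_le_add (Finset.sum_le_sum fun j _ => ?_) ?_
    · simp only [p, m]
      rw [sqDev_smul, sqDev_smul, hnp, hnm, inv_pow, h2, map_add, map_sub, norm_add_sq_real,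
        norm_sub_sq_real]
      set x := ‖Matrix.toEuclideanLin S (w j)‖ ^ 2
      set y := ‖Matrix.toEuclideanLin S u‖ ^ 2
      set z := inner ℝ (Matrix.toEuclideanLin S (w j)) (Matrix.toEuclideanLin S u)
      nlinarith [mul_nonneg (sq_nonneg (t : ℝ)) (sq_nonneg (x + y - 2))]
    · rw [sqDev_ofLp]
      apply le_of_eq
      ring
  · rw [integral_const_mul, integral_add hint iu.1, integral_finsetSum _ fun j _ => ipm j,
      inv_mul_eq_div, div_le_div_iff₀ (by positivity) ht0]
    have h3 : ∑ j, ∫ S, (sqDev (p j).ofLp S ^ 2 + sqDev (m j).ofLp S ^ 2) ∂(gaussianMatrix t d) ≤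
        ∑ _j : ι, 16 * (t : ℝ) := by
      refine Finset.sum_le_sum fun j _ => ?_
      rw [integral_add (ip j).1 (im j).1]
      linarith [(ip j).2, (im j).2]
    rw [Finset.sum_const, Finset.card_univ, nsmul_eq_mul] at h3
    have h4 := add_le_add h3 iu.2
    calc _ ≤ ((Fintype.card ι : ℝ) * (16 * t) + 8 * t) * t := by gcongr
      _ = _ := by ring

/-- Only subadditivity is used, so no set has to be measurable. -/
theorem nine_tenths_le_measure {Ω : Type*} [MeasurableSpace Ω] {μ : Measure Ω}
    [IsProbabilityMeasure μ] {A B G : Set Ω} (hA : μ.real A ≤ 1 / 20) (hB : μ.real B ≤ 1 / 20)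
    (hG : ∀ x, x ∉ A → x ∉ B → x ∈ G) : 9 / 10 ≤ μ G := by
  have hsub : Set.univ ⊆ G ∪ (A ∪ B) := fun x _ => by
    by_cases h1 : x ∈ A
    · exact Or.inr (Or.inl h1)
    by_cases h2 : x ∈ B
    · exact Or.inr (Or.inr h2)
    exact Or.inl (hG x h1 h2)
  have h1 : (1 : ℝ) ≤ μ.real G + (μ.real A + μ.real B) := by
    calc (1 : ℝ) = μ.real Set.univ := by simp
      _ ≤ _ := measureReal_mono hsub
      _ ≤ _ := measureReal_union_le _ _
      _ ≤ _ := by gcongr; exact measureReal_union_le _ _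
  have h2 : (9 / 10 : ENNReal) = ENNReal.ofReal (9 / 10) := by
    rw [ENNReal.ofReal_div_of_pos (by norm_num)]; simp
  rw [h2, ENNReal.ofReal_le_iff_le_toReal (measure_ne_top _ _)]
  change 9 / 10 ≤ μ.real G
  linarith

/-- A Gaussian sketch with `O(k)` rows nearly preserves sums of distances to a `k`-dimensional
subspace. -/
theorem gaussianMatrix_sum_norm {n d k t : ℕ} (hk : 1 ≤ k) (ht : 1000000 * (k : ℝ) ≤ t)
    (K : Submodule ℝ (EuclideanSpace ℝ (Fin d))) (hK : Module.finrank ℝ K ≤ k)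
    {r : Fin n → EuclideanSpace ℝ (Fin d)} (hr : ∀ i, r i ∈ Kᗮ) :
    9 / 10 ≤ gaussianMatrix t d {S |
      (∀ v : Fin n → EuclideanSpace ℝ (Fin d), (∀ i, v i ∈ K) →
        4 / 5 * ∑ i, ‖v i + r i‖ ≤ ∑ i, ‖Matrix.toEuclideanLin S (v i + r i)‖) ∧
      ∑ i, ‖Matrix.toEuclideanLin S (r i)‖ ≤ 6 / 5 * ∑ i, ‖r i‖} := by
  have hk1 : (1 : ℝ) ≤ k := by exact_mod_cast hk
  have ht0' : (0 : ℝ) < t := by linarith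
  have ht0 : 0 < t := by exact_mod_cast ht0'
  let w := stdOrthonormalBasis ℝ K
  -- The mean error is at most `(8k + 4)/t ≤ 12k/(10⁶ k) ≤ 1/50000`; Markov at level `1/1000` then
  -- fails with probability at most `1/50`.
  have hF : ∀ i, ∃ F : Matrix (Fin t) (Fin d) ℝ → ℝ, Integrable F (gaussianMatrix t d) ∧
      (∀ S, ‖r i‖ * sketchErr (Matrix.toEuclideanLin S) (fun j => (w j : EuclideanSpace ℝ (Fin d)))
        (‖r i‖⁻¹ • r i) ≤ F S) ∧
      ∫ S, F S ∂(gaussianMatrix t d) ≤ ‖r i‖ * (1 / 50000) := by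
    intro i
    rcases eq_or_ne (r i) 0 with h0 | h0
    · exact ⟨fun _ => 0, by simp, by simp [h0], by simp⟩
    obtain ⟨F, hF1, hF2, hF3⟩ := exists_sketchErr_bound (t := t)
      (w := fun j => (w j : EuclideanSpace ℝ (Fin d))) ht0
      (fun j => w.orthonormal.1 j) (norm_smul_inv_norm (𝕜 := ℝ) h0)
      (fun j => Kᗮ.smul_mem (‖r i‖⁻¹) (hr i) _ (w j).2)
    refine ⟨fun S => ‖r i‖ * F S, hF1.const_mul _, fun S =>
      mul_le_mul_of_nonneg_left (hF2 S) (norm_nonneg _), ?_⟩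
    rw [integral_const_mul]
    gcongr
    refine hF3.trans ?_
    rw [Fintype.card_fin, div_le_iff₀ ht0']
    have : (Module.finrank ℝ K : ℝ) ≤ k := by exact_mod_cast hK
    linarith
  choose F hF1 hF2 hF3 using hF
  have hR0 : 0 ≤ ∑ i, ‖r i‖ := Finset.sum_nonneg fun _ _ => norm_nonneg _
  let B : Set (Matrix (Fin t) (Fin d) ℝ) := {S | 1 / 1000 * ∑ i, ‖r i‖ <
    ∑ i, ‖r i‖ * sketchErr (Matrix.toEuclideanLin S) (fun j => (w j : EuclideanSpace ℝ (Fin d)))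
        (‖r i‖⁻¹ • r i)}
  have hB : (gaussianMatrix t d).real B ≤ 1 / 20 := by
    rcases hR0.eq_or_lt with h | h
    · have : B = ∅ := by
        ext S
        simp only [B, Set.mem_ofPred_eq, Set.mem_empty_iff_false, iff_false, not_lt]
        have h0 := (Finset.sum_eq_zero_iff_of_nonneg fun i _ => norm_nonneg (r i)).1 h.symm
        rw [Finset.sum_eq_zero fun i hi => by rw [h0 i hi, zero_mul], ← h]
        simp
      rw [this]; simp
    · have hsub : B ⊆ {S | 1 / 1000 * ∑ i, ‖r i‖ ≤ ∑ i, F i S} := by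
        intro S hS
        simp only [B, Set.mem_ofPred_eq] at hS ⊢
        exact hS.le.trans (Finset.sum_le_sum fun i _ => hF2 i S)
      have hmk := mul_meas_ge_le_integral_of_nonneg (μ := gaussianMatrix t d)
        (f := fun S => ∑ i, F i S)
        (ae_of_all _ fun S => Finset.sum_nonneg fun i _ =>
          (mul_nonneg (norm_nonneg _) (sketchErr_nonneg _ _ _)).trans (hF2 i S))
        (integrable_finsetSum _ fun i _ => hF1 i) (1 / 1000 * ∑ i, ‖r i‖)
      rw [integral_finsetSum _ fun i _ => hF1 i] at hmk
      have h3 := hmk.trans (Finset.sum_le_sum fun i _ => hF3 i)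
      rw [← Finset.sum_mul] at h3
      refine (measureReal_mono hsub).trans ?_
      by_contra! hcon
      nlinarith [mul_lt_mul_of_pos_left hcon h]
  refine nine_tenths_le_measure (gaussianMatrix_subspace_embedding hk ht K hK) hB
    fun S h1 h2 => ?_
  simp only [Set.mem_compl_iff, not_not, Set.mem_ofPred_eq] at h1
  simp only [B, Set.mem_ofPred_eq, not_lt] at h2
  exact sum_norm_map_ge _ w h1 hr h2

/-! ### Lopsided embeddings. -/

theorem norm12_nonneg {n d : ℕ} (M : Matrix (Fin n) (Fin d) ℝ) : 0 ≤ norm12 M :=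
  Finset.sum_nonneg fun _ _ => norm_nonneg _

theorem rank_eq_finrank_range_toEuclideanLin {p q : ℕ} (M : Matrix (Fin p) (Fin q) ℝ) :
    M.rank = Module.finrank ℝ (LinearMap.range (Matrix.toEuclideanLin M)) := by
  rw [Matrix.toEuclideanLin_eq_toLin_orthonormal]
  exact Matrix.rank_eq_finrank_range_toLin M _ _

/-- The residual of the orthogonal projection onto `K`. -/
theorem starProjection_sub_mem_orthogonal {E : Type*} [NormedAddCommGroup E]
    [InnerProductSpace ℝ E] (K : Submodule ℝ E) [K.HasOrthogonalProjection] (a : E) :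
    K.starProjection a - a ∈ Kᗮ := by
  rw [← neg_sub]
  exact Kᗮ.neg_mem (K.sub_starProjection_mem_orthogonal a)

theorem norm_starProjection_sub_le {E : Type*} [NormedAddCommGroup E]
    [InnerProductSpace ℝ E] (K : Submodule ℝ E) [K.HasOrthogonalProjection] (a : E) {v : E}
    (hv : v ∈ K) : ‖v - a‖ ^ 2 = ‖v - K.starProjection a‖ ^ 2 + ‖K.starProjection a - a‖ ^ 2 := by
  have h := starProjection_sub_mem_orthogonal K a (v - K.starProjection a)
    (K.sub_mem hv (K.starProjection_apply_mem a))
  have h2 := norm_add_sq_real (v - K.starProjection a) (K.starProjection a - a)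
  rw [h, sub_add_sub_cancel] at h2
  linarith

/-- Gaussian matrices with `O(k)` rows are lopsided embeddings. -/
theorem gaussianMatrix_isLopsidedEmbedding {n d k t : ℕ} (hk : 1 ≤ k)
    (ht : 1000000 * (k : ℝ) ≤ t) (V : Matrix (Fin d) (Fin k) ℝ) (A : Matrix (Fin n) (Fin d) ℝ) :
    9 / 10 ≤ gaussianMatrix t d {S | IsLopsidedEmbedding normH Set.univ (1 / 4) V Aᵀ S} := by
  let K := LinearMap.range (Matrix.toEuclideanLin V)
  have hK : Module.finrank ℝ K ≤ k := (LinearMap.finrank_range_le _).trans_eq (by simp)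
  let a : Fin n → EuclideanSpace ℝ (Fin d) := fun i => WithLp.toLp 2 (A i)
  have hX : ∀ (X : Matrix (Fin k) (Fin n) ℝ) (i : Fin n),
      (WithLp.toLp 2 ((V * X - Aᵀ)ᵀ i) : EuclideanSpace ℝ (Fin d)) =
        Matrix.toEuclideanLin V (WithLp.toLp 2 (Xᵀ i)) - a i := fun X i => rfl
  refine (gaussianMatrix_sum_norm hk ht K hK
    (fun i => starProjection_sub_mem_orthogonal K (a i))).trans (measure_mono ?_)
  rintro S ⟨h1, h2⟩
  refine ⟨fun X => ?_, fun X _ hmin => ?_⟩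
  · have := h1 (fun i => Matrix.toEuclideanLin V (WithLp.toLp 2 (Xᵀ i)) - K.starProjection (a i))
      fun i => K.sub_mem ⟨_, rfl⟩ (K.starProjection_apply_mem _)
    simp only [sub_add_sub_cancel] at this
    have h3 := norm12_nonneg (V * X - Aᵀ)ᵀ
    change (1 - 1 / 4) * norm12 (V * X - Aᵀ)ᵀ ≤ _
    change 4 / 5 * norm12 (V * X - Aᵀ)ᵀ ≤ normH (S * (V * X - Aᵀ)) at this
    linarith
  -- The columns of `X` vary independently, so projecting every column of `Aᵀ` is admissible.
  -- Minimality forces equality term by term, and by Pythagoras every minimizer is this projection,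
  -- whose residuals are the `r i` of the upper bound.
  · have hy : ∀ i, ∃ y : EuclideanSpace ℝ (Fin k),
        Matrix.toEuclideanLin V y = K.starProjection (a i) :=
      fun i => K.starProjection_apply_mem (a i)
    choose y hy using hy
    have hle : ∀ i ∈ Finset.univ, ‖K.starProjection (a i) - a i‖ ≤
        ‖Matrix.toEuclideanLin V (WithLp.toLp 2 (Xᵀ i)) - a i‖ := fun i _ => by
      refine le_of_sq_le_sq ?_ (norm_nonneg _)
      rw [norm_starProjection_sub_le K (a i) (v := Matrix.toEuclideanLin V _) ⟨_, rfl⟩]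
      linarith [sq_nonneg ‖Matrix.toEuclideanLin V (WithLp.toLp 2 (Xᵀ i)) -
        K.starProjection (a i)‖]
    have hge : ∑ i, ‖Matrix.toEuclideanLin V (WithLp.toLp 2 (Xᵀ i)) - a i‖ ≤
        ∑ i, ‖K.starProjection (a i) - a i‖ := by
      have h3 : normH (V * X - Aᵀ) ≤ normH (V * (Matrix.of fun i => (y i).ofLp)ᵀ - Aᵀ) :=
        hmin (Set.mem_univ _)
      simp_rw [← hy]
      exact h3
    have heq := (Finset.sum_eq_sum_iff_of_le hle).1 (le_antisymm (Finset.sum_le_sum hle) hge)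
    have hproj : ∀ i, Matrix.toEuclideanLin V (WithLp.toLp 2 (Xᵀ i)) = K.starProjection (a i) := by
      intro i
      have h3 := norm_starProjection_sub_le K (a i)
        (v := Matrix.toEuclideanLin V (WithLp.toLp 2 (Xᵀ i))) ⟨_, rfl⟩
      rw [← heq i (Finset.mem_univ _)] at h3
      have h4 : ‖Matrix.toEuclideanLin V (WithLp.toLp 2 (Xᵀ i)) -
          K.starProjection (a i)‖ ^ 2 = 0 := by linarith
      exact sub_eq_zero.1 (norm_eq_zero.1 (pow_eq_zero_iff two_ne_zero |>.1 h4))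
    simp_rw [← hproj] at h2
    change normH (S * (V * X - Aᵀ)) ≤ 6 / 5 * normH (V * X - Aᵀ) at h2
    have h3 : 0 ≤ normH (V * X - Aᵀ) := norm12_nonneg _
    linarith

/-! ### Low-rank regression and good sketches. -/

/-- Least squares over a subspace can be solved linearly in the right-hand side. -/
theorem exists_leastSquares {E G : Type*} [NormedAddCommGroup E] [InnerProductSpace ℝ E]
    [NormedAddCommGroup G] [InnerProductSpace ℝ G] [FiniteDimensional ℝ E]
    (T : E →ₗ[ℝ] G) (K : Submodule ℝ E) :
    ∃ g : G →ₗ[ℝ] E, (∀ b, g b ∈ K) ∧ ∀ b, ∀ v ∈ K, ‖T (g b) - b‖ ≤ ‖T v - b‖ := by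
  let f := T.domRestrict K
  obtain ⟨h, hh⟩ := LinearMap.exists_rightInverse_of_surjective f.rangeRestrict
    f.range_rangeRestrict
  let R := LinearMap.range f
  refine ⟨K.subtype ∘ₗ h ∘ₗ R.orthogonalProjectionOnto.toLinearMap, fun b => (h _).2,
    fun b v hv => ?_⟩
  have h1 : T ((K.subtype ∘ₗ h ∘ₗ R.orthogonalProjectionOnto.toLinearMap) b) = R.starProjection b :=
    congrArg Subtype.val (LinearMap.congr_fun hh (R.orthogonalProjectionOnto b))
  rw [h1]
  refine le_of_sq_le_sq ?_ (norm_nonneg _)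
  rw [norm_starProjection_sub_le R b (v := T v) ⟨⟨v, hv⟩, rfl⟩]
  linarith [sq_nonneg ‖T v - R.starProjection b‖]

/-- Least squares solves consistent systems exactly. With `G`, being of the form `W * Y` becomes the
closed condition `W * G * M = M`. -/
theorem exists_generalizedInverse {p q : ℕ} (W : Matrix (Fin p) (Fin q) ℝ) :
    ∃ G : Matrix (Fin q) (Fin p) ℝ, W * G * W = W := by
  obtain ⟨g, -, hg⟩ := exists_leastSquares (Matrix.toEuclideanLin W) ⊤
  refine ⟨Matrix.toEuclideanLin.symm g, ?_⟩
  apply Matrix.toEuclideanLin.injective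
  ext1 x
  have h := hg (Matrix.toEuclideanLin W x) x trivial
  rw [sub_self, norm_zero] at h
  have h2 := sub_eq_zero.1 (norm_le_zero_iff.1 h)
  have h3 : Matrix.toEuclideanLin (W * Matrix.toEuclideanLin.symm g * W) x =
      Matrix.toEuclideanLin W (Matrix.toEuclideanLin (Matrix.toEuclideanLin.symm g)
        (Matrix.toEuclideanLin W x)) := by
    simp [Matrix.toLpLin_apply, Matrix.mul_assoc]
  rw [h3, LinearEquiv.apply_symm_apply, h2]

/-- Lower semicontinuity of the rank: having rank at least `k + 1` is an open condition. -/
theorem isClosed_setOf_rank_le {p q : ℕ} (k : ℕ) :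
    IsClosed {M : Matrix (Fin p) (Fin q) ℝ | M.rank ≤ k} := by
  let φ : Matrix (Fin p) (Fin q) ℝ →ₗ[ℝ]
      (EuclideanSpace ℝ (Fin q) →L[ℝ] EuclideanSpace ℝ (Fin p)) :=
    LinearMap.toContinuousLinearMap.toLinearMap ∘ₗ Matrix.toEuclideanLin.toLinearMap
  have hφ : Continuous φ := φ.continuous_of_finiteDimensional
  have hopen := (isOpen_setOfPred_nat_le_rank (𝕜 := ℝ) (E := EuclideanSpace ℝ (Fin q))
    (F := EuclideanSpace ℝ (Fin p)) (k + 1)).preimage hφ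
  rw [← isOpen_compl_iff]
  convert hopen using 1
  ext M
  simp only [Set.mem_compl_iff, Set.mem_ofPred_eq, not_le, Set.mem_preimage]
  rw [rank_eq_finrank_range_toEuclideanLin]
  change _ ↔ ((k + 1 : ℕ) : Cardinal) ≤ LinearMap.rank (Matrix.toEuclideanLin M)
  rw [LinearMap.rank, ← Module.finrank_eq_rank, Nat.cast_le]
  rfl

theorem continuous_norm12 {n d : ℕ} : Continuous (norm12 : Matrix (Fin n) (Fin d) ℝ → ℝ) := by
  refine continuous_finsetSum _ fun i _ => ?_
  exact ((PiLp.continuous_toLp 2 fun _ : Fin d => ℝ).comp (continuous_apply i)).norm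

theorem abs_apply_le_norm12 {n d : ℕ} (M : Matrix (Fin n) (Fin d) ℝ) (i : Fin n) (j : Fin d) :
    |M i j| ≤ norm12 M := by
  calc |M i j| ≤ ‖(WithLp.toLp 2 (M i) : EuclideanSpace ℝ (Fin d))‖ :=
        PiLp.norm_apply_le (p := 2) (WithLp.toLp 2 (M i) : EuclideanSpace ℝ (Fin d)) j
    _ ≤ _ := Finset.single_le_sum
        (f := fun i => ‖(WithLp.toLp 2 (M i) : EuclideanSpace ℝ (Fin d))‖)
        (fun _ _ => norm_nonneg _) (Finset.mem_univ i)

/-- Low-rank regression in the `(1,2)`-norm attains its minimum. -/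
theorem exists_isMinOn_rank_le {n t d : ℕ} (k : ℕ) (W : Matrix (Fin n) (Fin t) ℝ)
    (B : Matrix (Fin n) (Fin d) ℝ) :
    ∃ X : Matrix (Fin t) (Fin d) ℝ, X.rank ≤ k ∧
      IsMinOn (fun Y => norm12 (W * Y - B)) {Y | Y.rank ≤ k} X := by
  obtain ⟨G, hG⟩ := exists_generalizedInverse W
  -- The minimization runs over the products `M = W * Y`, because sublevel sets in `Y` are unbounded
  -- when `W` has a kernel. The minimizer is pulled back as `G * M`, which does not raise the rank.
  let s : Set (Matrix (Fin n) (Fin d) ℝ) :=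
    {M | M.rank ≤ k} ∩ ({M | W * G * M = M} ∩ {M | norm12 (M - B) ≤ norm12 (0 - B)})
  have hcont : Continuous fun M : Matrix (Fin n) (Fin d) ℝ => norm12 (M - B) :=
    continuous_norm12.comp (continuous_id.sub continuous_const)
  have hclosed : IsClosed s := (isClosed_setOf_rank_le k).inter
    ((isClosed_eq (continuous_const.matrix_mul continuous_id) continuous_id).inter
      (isClosed_le hcont continuous_const))
  have hcpt : IsCompact s := by
    refine IsCompact.of_isClosed_subset (isCompact_univ_pi fun i => isCompact_univ_pi fun j =>
      isCompact_Icc (a := B i j - norm12 (0 - B)) (b := B i j + norm12 (0 - B))) hclosed ?_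
    rintro M ⟨-, -, hM⟩ i - j -
    have := abs_le.1 ((abs_apply_le_norm12 (M - B) i j).trans hM)
    rw [Matrix.sub_apply] at this
    exact ⟨by linarith [this.1], by linarith [this.2]⟩
  have hzero : (0 : Matrix (Fin n) (Fin d) ℝ) ∈ s := ⟨by simp, by simp, le_refl (norm12 (0 - B))⟩
  obtain ⟨M, hMs, hMmin⟩ := hcpt.exists_isMinOn ⟨0, hzero⟩ hcont.continuousOn
  refine ⟨G * M, (Matrix.rank_mul_le_right _ _).trans hMs.1, fun Y hY => ?_⟩
  change norm12 (W * (G * M) - B) ≤ norm12 (W * Y - B)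
  rw [← Matrix.mul_assoc, hMs.2.1]
  rcases le_total (norm12 (W * Y - B)) (norm12 (0 - B)) with h | h
  · exact hMmin ⟨(Matrix.rank_mul_le_right _ _).trans hY, by
      change W * G * (W * Y) = W * Y
      rw [← Matrix.mul_assoc, hG], h⟩
  · exact (hMmin hzero).trans h

/-- Projecting the rows of `A` onto any admissible subspace gives a competitor of rank at most `k`.
A best low-rank approximation therefore beats every subspace, hence the infimum, with no need for an
optimal subspace. -/
theorem exists_rank_le_norm12_le_subApx {n d : ℕ} (k : ℕ) (A : Matrix (Fin n) (Fin d) ℝ) :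
    ∃ M : Matrix (Fin n) (Fin d) ℝ, M.rank ≤ k ∧ norm12 (M - A) ≤ subApx k A := by
  obtain ⟨M, hM, hmin⟩ := exists_isMinOn_rank_le k (1 : Matrix (Fin n) (Fin n) ℝ) A
  refine ⟨M, hM, ?_⟩
  have : Nonempty {P : Submodule ℝ (EuclideanSpace ℝ (Fin d)) // Module.finrank ℝ P ≤ k} :=
    ⟨⟨⊥, by simp⟩⟩
  refine le_ciInf fun P => ?_
  let Q := Matrix.toEuclideanLin.symm P.1.starProjection.toLinearMap
  have hQ : (Q * Aᵀ)ᵀ.rank ≤ k := by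
    rw [Matrix.rank_transpose]
    refine (Matrix.rank_mul_le_left _ _).trans ?_
    rw [rank_eq_finrank_range_toEuclideanLin, LinearEquiv.apply_symm_apply]
    refine le_trans (Submodule.finrank_mono ?_) P.2
    rintro _ ⟨x, rfl⟩
    exact P.1.starProjection_apply_mem x
  have h1 : norm12 (M - A) ≤ norm12 ((Q * Aᵀ)ᵀ - A) := by
    simpa only [Set.mem_ofPred_eq, Matrix.one_mul] using hmin hQ
  refine h1.trans (Finset.sum_le_sum fun i _ => ?_)
  have h2 : (WithLp.toLp 2 (((Q * Aᵀ)ᵀ - A) i) : EuclideanSpace ℝ (Fin d)) =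
      P.1.starProjection (WithLp.toLp 2 (A i)) - WithLp.toLp 2 (A i) := by
    change Matrix.toEuclideanLin Q (WithLp.toLp 2 (A i)) - WithLp.toLp 2 (A i) = _
    rw [LinearEquiv.apply_symm_apply]
    rfl
  rw [h2, norm_sub_rev, P.1.starProjection_minimal, Metric.infDist_eq_iInf]
  simp_rw [dist_eq_norm]
  exact le_rfl

/-- Gaussian matrices with `O(k)` rows are good sketches for subspace approximation. -/
theorem gaussianMatrix_isGoodSketch {n d k t : ℕ} (hk : 1 ≤ k)
    (ht : 1000000 * (k : ℝ) ≤ t) (A : Matrix (Fin n) (Fin d) ℝ) :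
    9 / 10 ≤ gaussianMatrix t d {S | IsGoodSketch k A S} := by
  obtain ⟨M, hM, hMA⟩ := exists_rank_le_norm12_le_subApx k A
  let K := LinearMap.range (Matrix.toEuclideanLin Mᵀ)
  have hK : Module.finrank ℝ K ≤ k := by
    rwa [← rank_eq_finrank_range_toEuclideanLin, Matrix.rank_transpose]
  let a : Fin n → EuclideanSpace ℝ (Fin d) := fun i => WithLp.toLp 2 (A i)
  have hres : ∑ i, ‖K.starProjection (a i) - a i‖ ≤ subApx k A := by
    refine le_trans (Finset.sum_le_sum fun i _ => le_of_sq_le_sq ?_ (norm_nonneg _)) hMA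
    have hmem : (WithLp.toLp 2 (M i) : EuclideanSpace ℝ (Fin d)) ∈ K := by
      refine ⟨WithLp.toLp 2 (Pi.single i 1), ?_⟩
      rw [Matrix.toLpLin_apply]
      simp
      rfl
    have h3 := norm_starProjection_sub_le K (a i) hmem
    have h4 : (WithLp.toLp 2 ((M - A) i) : EuclideanSpace ℝ (Fin d)) =
      WithLp.toLp 2 (M i) - a i := rfl
    rw [h4, h3]
    linarith [sq_nonneg ‖(WithLp.toLp 2 (M i) : EuclideanSpace ℝ (Fin d)) -
      K.starProjection (a i)‖]
  refine (gaussianMatrix_sum_norm hk ht K hK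
    (fun i => starProjection_sub_mem_orthogonal K (a i))).trans (measure_mono ?_)
  rintro S ⟨h1, h2⟩
  obtain ⟨X, hXr, hXmin⟩ := exists_isMinOn_rank_le k (A * Sᵀ) A
  refine ⟨X, hXr, hXmin, ?_⟩
  -- As `g` is linear with values in `K`, one matrix `Qᵀ` of rank at most `k` serves all rows.
  obtain ⟨g, hgK, hg⟩ := exists_leastSquares (Matrix.toEuclideanLin S) K
  let Q := Matrix.toEuclideanLin.symm g
  have hQ : Qᵀ.rank ≤ k := by
    rw [Matrix.rank_transpose, rank_eq_finrank_range_toEuclideanLin, LinearEquiv.apply_symm_apply]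
    refine le_trans (Submodule.finrank_mono ?_) hK
    rintro _ ⟨x, rfl⟩
    exact hgK x
  have h3 : norm12 (A * Sᵀ * X - A) ≤ norm12 (A * Sᵀ * Qᵀ - A) := hXmin hQ
  refine h3.trans ?_
  have h4 : A * Sᵀ * Qᵀ - A = (Q * (S * Aᵀ) - Aᵀ)ᵀ := by
    simp [Matrix.transpose_mul, Matrix.transpose_sub, Matrix.mul_assoc]
  have h5 : norm12 (A * Sᵀ * Qᵀ - A) = ∑ i, ‖g (Matrix.toEuclideanLin S (a i)) - a i‖ := by
    rw [h4]
    refine Finset.sum_congr rfl fun i _ => congrArg norm ?_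
    change Matrix.toEuclideanLin Q (Matrix.toEuclideanLin S (a i)) - a i = _
    rw [LinearEquiv.apply_symm_apply]
  rw [h5]
  have h6 := h1 (fun i => g (Matrix.toEuclideanLin S (a i)) - K.starProjection (a i))
    fun i => K.sub_mem (hgK _) (K.starProjection_apply_mem _)
  simp only [sub_add_sub_cancel] at h6
  -- Optimality of `g` in the sketched problem; with `h6` and `h2`, `4/5` of the cost is at most
  -- `6/5` of the optimum.
  have h7 : ∑ i, ‖Matrix.toEuclideanLin S (g (Matrix.toEuclideanLin S (a i)) - a i)‖ ≤
      ∑ i, ‖Matrix.toEuclideanLin S (K.starProjection (a i) - a i)‖ := by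
    refine Finset.sum_le_sum fun i _ => ?_
    rw [map_sub, map_sub]
    exact hg _ _ (K.starProjection_apply_mem _)
  linarith

/-! ### From `ℓ₁` bounds on vectors to `(1,2)`-bounds on matrices. -/

theorem integrable_abs_gaussianReal (v : ℝ≥0) : Integrable (fun x : ℝ => |x|) (gaussianReal 0 v) :=
  (memLp_one_iff_integrable.1 (memLp_id_gaussianReal (μ := 0) (v := v) 1)).abs

/-- Otherwise a standard Gaussian would vanish almost surely, against its variance `1`. Positivity
allows this constant to be cancelled. -/
theorem integral_abs_gaussianReal_pos : 0 < ∫ x, |x| ∂(gaussianReal 0 1) := by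
  refine (integral_nonneg fun _ => abs_nonneg _).lt_of_ne' fun h => ?_
  rw [integral_eq_zero_iff_of_nonneg (fun _ => abs_nonneg _) (integrable_abs_gaussianReal 1)] at h
  have h1 : ∀ᵐ x ∂(gaussianReal 0 1), x = (0 : ℝ) := by
    filter_upwards [h] with x hx using abs_eq_zero.1 hx
  have h2 := variance_id_gaussianReal (μ := 0) (v := 1)
  rw [variance_congr (X := id) (Y := fun _ => 0) h1] at h2
  rw [variance_eq_integral aemeasurable_const] at h2
  simp at h2

/-- The mean absolute value of a Gaussian linear functional is proportional to its norm. -/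
theorem integral_abs_dotProduct {d : ℕ} (a : Fin d → ℝ) :
    Integrable (fun s : Fin d → ℝ => |a ⬝ᵥ s|) (Measure.pi fun _ : Fin d => gaussianReal 0 1) ∧
      ∫ s, |a ⬝ᵥ s| ∂(Measure.pi fun _ : Fin d => gaussianReal 0 1) =
        ‖(WithLp.toLp 2 a : EuclideanSpace ℝ (Fin d))‖ * ∫ x, |x| ∂(gaussianReal 0 1) := by
  have hlaw := map_dotProduct_pi_gaussianReal 1 a
  have hm : Measurable (fun s : Fin d → ℝ => s ⬝ᵥ a) := by unfold dotProduct; fun_prop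
  have hi := integrable_abs_gaussianReal (1 * ‖(WithLp.toLp 2 a : EuclideanSpace ℝ (Fin d))‖₊ ^ 2)
  have h2 := gaussianReal_map_const_mul (μ := 0) (v := 1)
    ‖(WithLp.toLp 2 a : EuclideanSpace ℝ (Fin d))‖
  have h3 : NNReal.mk (‖(WithLp.toLp 2 a : EuclideanSpace ℝ (Fin d))‖ ^ 2) (sq_nonneg _) * 1 =
      1 * ‖(WithLp.toLp 2 a : EuclideanSpace ℝ (Fin d))‖₊ ^ 2 := by
    rw [mul_comm]; rfl
  rw [mul_zero, h3] at h2
  have e := integral_map (μ := gaussianReal 0 1)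
    (φ := fun x => ‖(WithLp.toLp 2 a : EuclideanSpace ℝ (Fin d))‖ * x)
    (f := fun x : ℝ => |x|) (by fun_prop) (by fun_prop)
  rw [← hlaw] at hi h2
  rw [integrable_map_measure (by fun_prop) hm.aemeasurable] at hi
  rw [h2, integral_map hm.aemeasurable (by fun_prop)] at e
  simp_rw [abs_mul, integral_const_mul, abs_norm] at e
  simp_rw [dotProduct_comm a]
  exact ⟨hi, e⟩

theorem integral_norm1_mulVec {n d : ℕ} (M : Matrix (Fin n) (Fin d) ℝ) :
    Integrable (fun s => norm1 (M *ᵥ s)) (Measure.pi fun _ : Fin d => gaussianReal 0 1) ∧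
      ∫ s, norm1 (M *ᵥ s) ∂(Measure.pi fun _ : Fin d => gaussianReal 0 1) =
        norm12 M * ∫ x, |x| ∂(gaussianReal 0 1) := by
  have h := fun i => integral_abs_dotProduct (M i)
  refine ⟨integrable_finsetSum _ fun i _ => (h i).1, ?_⟩
  rw [norm12, Finset.sum_mul]
  simp_rw [← (h _).2]
  exact integral_finsetSum _ fun i _ => (h i).1

/-- A lower `ℓ₁` embedding bound lifts to the `(1,2)`-norm. -/
theorem norm12_mul_le_of_norm1_mulVec_le {n m t d : ℕ} {M : Matrix (Fin n) (Fin t) ℝ}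
    {N : Matrix (Fin m) (Fin t) ℝ} {α : ℝ}
    (h : ∀ y, α * norm1 (M *ᵥ y) ≤ norm1 (N *ᵥ y)) (X : Matrix (Fin t) (Fin d) ℝ) :
    α * norm12 (M * X) ≤ norm12 (N * X) := by
  have h1 := integral_norm1_mulVec (M * X)
  have h2 := integral_norm1_mulVec (N * X)
  -- The hypothesis is applied at `y = X s` with `s` Gaussian and integrated over `s`.
  have h3 := integral_mono (h1.1.const_mul α) h2.1 fun s => by
    beta_reduce
    rw [← Matrix.mulVec_mulVec, ← Matrix.mulVec_mulVec]
    exact h _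
  rw [integral_const_mul, h1.2, h2.2, ← mul_assoc] at h3
  exact le_of_mul_le_mul_right h3 integral_abs_gaussianReal_pos

theorem norm12_add_le {n d : ℕ} (M N : Matrix (Fin n) (Fin d) ℝ) :
    norm12 (M + N) ≤ norm12 M + norm12 N := by
  rw [norm12, norm12, norm12, ← Finset.sum_add_distrib]
  exact Finset.sum_le_sum fun i _ => norm_add_le
    (WithLp.toLp 2 (M i) : EuclideanSpace ℝ (Fin d)) (WithLp.toLp 2 (N i))

theorem norm12_neg {n d : ℕ} (M : Matrix (Fin n) (Fin d) ℝ) : norm12 (-M) = norm12 M :=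
  Finset.sum_congr rfl fun i _ => norm_neg (WithLp.toLp 2 (M i) : EuclideanSpace ℝ (Fin d))

theorem norm12_sub_le {n d : ℕ} (M N : Matrix (Fin n) (Fin d) ℝ) :
    norm12 (M - N) ≤ norm12 M + norm12 N := by
  rw [sub_eq_add_neg, ← norm12_neg N]
  exact norm12_add_le _ _

/-! ### Transfer of sketched costs. -/

instance {p q : ℕ} : BorelSpace (Matrix (Fin p) (Fin q) ℝ) :=
  inferInstanceAs (BorelSpace (Fin p → Fin q → ℝ))

instance {p q : ℕ} : SecondCountableTopology (Matrix (Fin p) (Fin q) ℝ) :=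
  inferInstanceAs (SecondCountableTopology (Fin p → Fin q → ℝ))

/-- For each `y` the conditions are closed, so the uncountable intersection over `y` is closed as
well. -/
theorem measurableSet_isL1SubspaceEmbedding {n d t m : ℕ} (A : Matrix (Fin n) (Fin d) ℝ)
    (α β : ℝ) : MeasurableSet {q : Matrix (Fin t) (Fin d) ℝ × Matrix (Fin m) (Fin n) ℝ |
      IsL1SubspaceEmbedding α β (A * q.1ᵀ) q.2} := by
  have hn : ∀ p : ℕ, Continuous (norm1 : (Fin p → ℝ) → ℝ) := fun p => by
    unfold norm1; fun_prop
  have hM : Continuous fun q : Matrix (Fin t) (Fin d) ℝ × Matrix (Fin m) (Fin n) ℝ => A * q.1ᵀ :=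
    continuous_const.matrix_mul continuous_fst.matrix_transpose
  refine IsClosed.measurableSet ?_
  simp only [IsL1SubspaceEmbedding, Set.ofPred_forall, Set.ofPred_and]
  refine isClosed_iInter fun y => IsClosed.inter (isClosed_le ?_ ?_) (isClosed_le ?_ ?_)
  · exact continuous_const.mul ((hn _).comp (hM.matrix_mulVec continuous_const))
  · exact (hn _).comp ((continuous_snd.matrix_mul hM).matrix_mulVec continuous_const)
  · exact (hn _).comp ((continuous_snd.matrix_mul hM).matrix_mulVec continuous_const)
  · exact continuous_const.mul ((hn _).comp (hM.matrix_mulVec continuous_const))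

/-- If an `ℓ₁` subspace embedding does not blow up one good solution, then it transfers costs. -/
theorem norm12_le_of_isL1SubspaceEmbedding {n d t m : ℕ} {A : Matrix (Fin n) (Fin d) ℝ}
    {S : Matrix (Fin t) (Fin d) ℝ} {L : Matrix (Fin m) (Fin n) ℝ} {α β o : ℝ} (hα : 0 < α)
    (hL : IsL1SubspaceEmbedding α β (A * Sᵀ) L) {Y : Matrix (Fin t) (Fin d) ℝ}
    (hY : norm12 (A * Sᵀ * Y - A) ≤ 3 / 2 * o) (hLY : norm12 (L * (A * Sᵀ * Y - A)) ≤ 10 * o)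
    {X : Matrix (Fin t) (Fin d) ℝ} (hX : norm12 (L * A * Sᵀ * X - L * A) ≤ 10 * o) :
    norm12 (A * Sᵀ * X - A) ≤ (2 + 40 / α) * o := by
  have ho : 0 ≤ o := by linarith [norm12_nonneg (A * Sᵀ * Y - A)]
  have h1 : A * Sᵀ * X - A = A * Sᵀ * (X - Y) + (A * Sᵀ * Y - A) := by
    rw [Matrix.mul_sub]; abel
  have h2 : L * (A * Sᵀ) * (X - Y) =
      (L * A * Sᵀ * X - L * A) - L * (A * Sᵀ * Y - A) := by
    simp only [Matrix.mul_sub, Matrix.mul_assoc]; abel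
  -- Both `X` and `Y` have sketched cost at most `10 * o`, so the sketch of their difference is at
  -- most `20 * o`.
  have h3 := norm12_mul_le_of_norm1_mulVec_le (fun y => (hL y).1) (X - Y)
  rw [h2] at h3
  have h4 := h3.trans (norm12_sub_le _ _)
  have h5 := norm12_add_le (A * Sᵀ * (X - Y)) (A * Sᵀ * Y - A)
  rw [← h1] at h5
  have h6 : norm12 (A * Sᵀ * (X - Y)) ≤ 20 * o / α := by
    rw [le_div_iff₀ hα]; linarith
  have h7 : (2 + 40 / α) * o = 2 * o + 2 * (20 * o / α) := by ring
  have h8 : 0 ≤ 20 * o / α := by positivity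
  linarith

/-- Markov's inequality, `(3/2)/10 = 3/20`. At `o = 0` it is void, but then the mean is zero and the
norm vanishes almost surely. -/
theorem measure_norm12_mul_gt_le {n m p : ℕ} {ν : Measure (Matrix (Fin m) (Fin n) ℝ)}
    [IsProbabilityMeasure ν] (hν : IsUnbiased12 ν) {M : Matrix (Fin n) (Fin p) ℝ} {o : ℝ}
    (hM : norm12 M ≤ 3 / 2 * o) : ν {L | 10 * o < norm12 (L * M)} ≤ ENNReal.ofReal (3 / 20) := by
  obtain ⟨hi, he⟩ := hν p M
  have ho : 0 ≤ o := by linarith [norm12_nonneg M]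
  rcases ho.eq_or_lt with rfl | ho
  · have h0 : norm12 M = 0 := le_antisymm (by simpa using hM) (norm12_nonneg M)
    rw [h0, integral_eq_zero_iff_of_nonneg (fun L => norm12_nonneg _) hi] at he
    have : ν {L | 10 * 0 < norm12 (L * M)} = 0 := by
      refine measure_mono_null ?_ (ae_iff.1 he)
      intro L hL
      simp only [Set.mem_ofPred_eq, mul_zero] at hL ⊢
      exact hL.ne'
    rw [this]
    exact zero_le
  · have h := mul_meas_ge_le_integral_of_nonneg
      (ae_of_all _ fun L => norm12_nonneg (L * M)) hi (10 * o)
    rw [he] at h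
    rw [← ofReal_measureReal]
    have hsub : {L : Matrix (Fin m) (Fin n) ℝ | 10 * o < norm12 (L * M)} ⊆
        {L | 10 * o ≤ norm12 (L * M)} := fun L hL => le_of_lt (Set.mem_ofPred_eq ▸ hL)
    refine ENNReal.ofReal_le_ofReal ((measureReal_mono hsub).trans ?_)
    by_contra! hcon
    nlinarith [mul_lt_mul_of_pos_left hcon ho]

/-- A good sketch lets sketched costs be transferred to true costs. -/
theorem sketchedCostTransfers_of_isGoodSketch {n d t k : ℕ} {A : Matrix (Fin n) (Fin d) ℝ}
    {μ : Measure (Matrix (Fin t) (Fin d) ℝ)} [IsProbabilityMeasure μ]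
    (hμ : 9 / 10 ≤ μ {S | IsGoodSketch k A S}) : SketchedCostTransfers k A μ := by
  intro m κ _ α β hα hub hemb
  set T : Set (Matrix (Fin t) (Fin d) ℝ × Matrix (Fin m) (Fin n) ℝ) :=
    {q | ∀ X : Matrix (Fin t) (Fin d) ℝ,
      norm12 (q.2 * A * q.1ᵀ * X - q.2 * A) ≤ 10 * subApx k A →
      norm12 (A * q.1ᵀ * X - A) ≤ (2 + 40 / α) * subApx k A} with hT
  have hF := measurableSet_isL1SubspaceEmbedding (m := m) (t := t) A α β
  set F := {q : Matrix (Fin t) (Fin d) ℝ × Matrix (Fin m) (Fin n) ℝ |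
    IsL1SubspaceEmbedding α β (A * q.1ᵀ) q.2}
  -- `T` is not known to be measurable; its measurable hull has the same measure.
  have hT' : MeasurableSet (toMeasurable (μ ⊗ₘ κ) T) := measurableSet_toMeasurable _ _
  let ψ := fun S => κ S (Prod.mk S ⁻¹' toMeasurable (μ ⊗ₘ κ) T)
  let φ := fun S => κ S (Prod.mk S ⁻¹' F)
  have hψm : Measurable ψ := Kernel.measurable_kernel_prodMk_left hT'
  have hφm : Measurable φ := Kernel.measurable_kernel_prodMk_left hF
  let c : ENNReal := ENNReal.ofReal (3 / 20)
  -- `D` is a measurable substitute for the set of good sketches, which it contains up to a null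
  -- set.
  let D : Set (Matrix (Fin t) (Fin d) ℝ) := {S | φ S ≤ ψ S + c}
  have hD : MeasurableSet D := measurableSet_le hφm (hψm.add_const c)
  have hGD : μ {S | IsGoodSketch k A S} ≤ μ D := by
    refine measure_mono_ae ?_
    filter_upwards [hub] with S hS hgood
    obtain ⟨Y, -, -, hY⟩ := (show IsGoodSketch k A S from hgood)
    have hsub : Prod.mk S ⁻¹' F ⊆ Prod.mk S ⁻¹' toMeasurable (μ ⊗ₘ κ) T ∪
        {L | 10 * subApx k A < norm12 (L * (A * Sᵀ * Y - A))} := by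
      intro L hL
      by_cases hLY : norm12 (L * (A * Sᵀ * Y - A)) ≤ 10 * subApx k A
      · exact Or.inl (subset_toMeasurable (μ ⊗ₘ κ) T
          (show (S, L) ∈ T from fun X hX => norm12_le_of_isL1SubspaceEmbedding hα hL hY hLY hX))
      · exact Or.inr (not_le.1 hLY)
    calc κ S (Prod.mk S ⁻¹' F) ≤ _ := measure_mono hsub
      _ ≤ _ := measure_union_le _ _
      _ ≤ _ := by gcongr; exact measure_norm12_mul_gt_le hS hY
  have hDc : μ Dᶜ ≤ 1 - 9 / 10 := by
    rw [prob_compl_eq_one_sub hD]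
    exact tsub_le_tsub_left (hμ.trans hGD) 1
  have hpt : ∀ S, φ S ≤ ψ S + c + Dᶜ.indicator 1 S := by
    intro S
    by_cases hS : S ∈ D
    · exact le_add_right hS
    · rw [Set.indicator_of_mem (Set.mem_compl hS)]
      exact prob_le_one.trans le_add_self
  rw [Measure.compProd_apply hF] at hemb
  -- This leaves probability at least `9/10 - 3/20 - 1/10 = 13/20 ≥ 3/5`.
  have hmain : 9 / 10 ≤ (∫⁻ S, ψ S ∂μ) + c + (1 - 9 / 10) := by
    calc (9 / 10 : ENNReal) ≤ ∫⁻ S, φ S ∂μ := hemb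
      _ ≤ ∫⁻ S, ψ S + c + Dᶜ.indicator 1 S ∂μ := lintegral_mono hpt
      _ = (∫⁻ S, ψ S ∂μ) + c + μ Dᶜ := by
          rw [lintegral_add_left (hψm.add_const c), lintegral_add_left hψm, lintegral_const,
            measure_univ, mul_one, lintegral_indicator_one hD.compl]
      _ ≤ _ := by gcongr
  rw [← measure_toMeasurable T, Measure.compProd_apply hT']
  change 3 / 5 ≤ ∫⁻ S, ψ S ∂μ
  generalize (∫⁻ S, ψ S ∂μ) = x at hmain ⊢
  rcases eq_or_ne x ⊤ with rfl | hx
  · exact le_top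
  have e1 : (9 / 10 : ENNReal) = ENNReal.ofReal (9 / 10) := by
    rw [ENNReal.ofReal_div_of_pos (by norm_num)]; simp
  have e2 : (3 / 5 : ENNReal) = ENNReal.ofReal (3 / 5) := by
    rw [ENNReal.ofReal_div_of_pos (by norm_num)]; simp
  have e3 : (1 - 9 / 10 : ENNReal) = ENNReal.ofReal (1 / 10) := by
    rw [e1, ← ENNReal.ofReal_one, ← ENNReal.ofReal_sub _ (by norm_num)]; norm_num
  rw [e3, e1, ← ENNReal.ofReal_toReal hx, ← ENNReal.ofReal_add (by positivity) (by norm_num),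
    ← ENNReal.ofReal_add (by positivity) (by norm_num),
    ENNReal.ofReal_le_ofReal_iff (by positivity)] at hmain
  rw [e2, ← ENNReal.ofReal_toReal hx]
  exact ENNReal.ofReal_le_ofReal (by linarith)

theorem mainTheorem8 :
    ∃ C : ℝ, 0 < C ∧
      ∀ (n d k : ℕ), 1 ≤ k → ∀ A : Matrix (Fin n) (Fin d) ℝ,
        -- Gaussian sketches with `O(k)` rows
        (∀ t : ℕ, C * (k : ℝ) ≤ (t : ℝ) →
          (∀ (U : Matrix (Fin n) (Fin k) ℝ) (V : Matrix (Fin d) (Fin k) ℝ),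
            norm12 (U * Vᵀ - A) = subApx k A →
            9 / 10 ≤ gaussianMatrix t d
              {S | IsLopsidedEmbedding normH Set.univ (1 / 4) V Aᵀ S}) ∧
          9 / 10 ≤ gaussianMatrix t d {S | IsGoodSketch k A S} ∧
          SketchedCostTransfers k A (gaussianMatrix t d)) ∧
        -- the second part only uses the bound on the minimum, with probability `9/10`
        (∀ (t : ℕ) (μ : Measure (Matrix (Fin t) (Fin d) ℝ)) [IsProbabilityMeasure μ],
          9 / 10 ≤ μ {S | IsGoodSketch k A S} → SketchedCostTransfers k A μ) := by
  refine ⟨1000000, by norm_num, fun n d k hk A => ⟨fun t ht => ⟨fun U V _ => ?_, ?_, ?_⟩, ?_⟩⟩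
  · exact gaussianMatrix_isLopsidedEmbedding hk ht V A
  · exact gaussianMatrix_isGoodSketch hk ht A
  · exact sketchedCostTransfers_of_isGoodSketch (gaussianMatrix_isGoodSketch hk ht A)
  · exact fun t μ _ hμ => sketchedCostTransfers_of_isGoodSketch hμ
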